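/- Let $\delta\ge 1$ be an integer and $\tau=\tau_1+i\tau_2\in\mathbb{C}$ with $\tau_2>0$. Put $V=\mathbb{C}$ with coordinate $z=z_1+iz_2$, $\Lambda=\mathbb{Z}\delta+\mathbb{Z}\tau$ and $M=V/\Lambda$. Line bundles on a torus $W/L$ are described by multipliers: sections of the bundle with multipliers $(e_l)_{l\in L}$ are functions $s$ on $W$ with $s(w+l)=e_l(w)s(w)$, and a Hermitian metric is a positive smooth function $h$ on $W$ (the squared norm of $s$ is $h|s|^2$). Let $L_0\to M$ be the holomorphic line bundle with multipliers $e_\delta=1$, $e_\tau(z)=e^{-2\pi i z-\pi i\tau}$. Let $\overline V^*$ be the complex vector space of conjugate linear functionals on $V$, let $\overline\Lambda^*=\{\alpha\in\overline V^*: 2\,\mathrm{Re}\,\alpha(\Lambda)\subset\mathbb{Z}\}$ and $\widehat M=\overline V^*/\overline\Lambda^*$. Identify $\widehat M$ with $\mathrm{Pic}^0(M)$ by letting $[\alpha]$ correspond to the line bundle $P_\alpha$ with the constant multipliers $e_\lambda=e^{2\pi i\alpha(\lambda)}$. Let $\varphi_{L_0}:M\to\widehat M$ be the map $[\mu]\mapsto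 \mathcal{T}_\mu^*L_0\otimes L_0^*$, where $\mathcal{T}_\mu$ is the translation by $[\mu]$. Let $\mathrm{P}\to M\times\widehat M$ be the Poincaré line bundle: a holomorphic line bundle with $\mathrm{P}|_{M\times\{[\alpha]\}}\cong P_\alpha$ for all $\alpha$ and with $\mathrm{P}|_{\{0\}\times\widehat M}$ holomorphically trivial. Let $V^*=\mathrm{Hom}(V,\mathbb{R})$, let $\Lambda^*\subset V^*$ be the forms that are integral on $\Lambda$, and $M^*=V^*/2\pi\Lambda^*$. Let $\mathcal{P}\to M\times M^*$ be the quotient of the trivial line bundle over $M\times V^*$ by the action $2\pi\nu\circ(x,\xi,\sigma)=(x,\xi+2\pi\nu,e^{-2\pi i\nu(x)}\sigma)$ of $2\pi\Lambda^*$, with the metric $h_{\mathcal{P}}$ induced by $\sigma_1\overline{\sigma_2}$ and the unitary connection $\nabla^{\mathcal{P}}$ induced by $d+i\xi$. Let $\widetilde{Iso}:M\times\widehat M\to M\times M^*$ be the product of the identity with the isomorphism induced by $\alpha\mapsto 2\pi(\alpha+\overline\alpha)$, and give $\widetilde{Iso}^*\mathcal{P}$ the holomorphic structure whose $\bar\partial$-operator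 is the $(0,1)$-part of $\widetilde{Iso}^*\nabla^{\mathcal{P}}$. On $M\times M$, with coordinates $z$ and $\mu=\mu_1+i\mu_2$, let $J$ be the holomorphic line bundle with multipliers $$e_{(\delta,0)}=1,\quad e_{(\tau,0)}=e^{-2\pi i\mu},\quad e_{(0,\delta)}=1,\quad e_{(0,\tau)}=e^{-2\pi i z}.$$ Let $h_J$ be the metric on $J$ induced by the metrics $e^{-\frac{2\pi}{\tau_2}z_2^2}$ on $L_0$ and $e^{-\frac{2\pi}{\tau_2}(z_2+\mu_2)^2}$ on $\pi_1^*L_0\otimes J\otimes\pi_2^*L_0$, and let $\Theta_J=-\partial\bar\partial\log h_J$ be its curvature. Theorem. The map $\varphi_{L_0}$ is well defined by its description, it has a unique complex linear lift $V\to\overline V^*$, and a Poincaré line bundle exists. Let $\mathrm{P}$ be any Poincaré line bundle and fix a holomorphic trivialization $t$ of $\mathrm{P}|_{\{0\}\times\widehat M}$. There are unique holomorphic isomorphisms $$\Psi:\mathrm{P}\to\widetilde{Iso}^*\mathcal{P}\quad\text{and}\quad \Phi:(Id\times\varphi_{L_0})^*\mathrm{P}\to J$$ that carry $t$, respectively its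 pull-back, to the section $1$ over $\{0\}\times\widehat M$, respectively over $\{0\}\times M$ (the multipliers of $\widetilde{Iso}^*\mathcal{P}$ and $J$ are trivial there). Let $h_{\mathrm{P}}$ and $\nabla^{\mathrm{P}}$ be the metric and the connection on $\mathrm{P}$ that correspond under $\Psi$ to $\widetilde{Iso}^*h_{\mathcal{P}}$ and $\widetilde{Iso}^*\nabla^{\mathcal{P}}$, let $\Theta_{\mathrm{P}}$ be the curvature of $\nabla^{\mathrm{P}}$, and let $h_{(Id\times\varphi_{L_0})^*\mathrm{P}}$, $\Theta_{(Id\times\varphi_{L_0})^*\mathrm{P}}$ be the metric $h_J$, transported by $\Phi$, and its curvature $\Theta_J$. Then, on $M\times M$, (1) $(Id\times\varphi_{L_0})^*\Theta_{\mathrm{P}}=\Theta_{(Id\times\varphi_{L_0})^*\mathrm{P}}=\dfrac{\pi}{\tau_2}\,(dz\wedge d\bar\mu+d\mu\wedge d\bar z)$; (2) $(Id\times\varphi_{L_0})^*h_{\mathrm{P}}=h_{(Id\times\varphi_{L_0})^*\mathrm{P}}$, where $h_J(z,\mu)=e^{-\frac{4\pi}{\tau_2}z_2\mu_2}$. -/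

import Mathlib

open scoped ContDiff ComplexConjugate

noncomputable section

namespace PoincareTorus

/-! ## Line bundles on a torus `W / L`, described by multipliers on the universal cover `W`

A section of the bundle with multipliers `e` is a function `s` on `W` such that
`s (w + l) = e l w * s w` for all `l ∈ L`. -/

/-- A holomorphic line bundle on `W / L`, given by a system of multipliers. -/
structure HolLineBundle (W : Type) [NormedAddCommGroup W] [NormedSpace ℂ W]
    (L : AddSubgroup W) where
  mult : L → W → ℂ
  holomorphic : ∀ l, Differentiable ℂ (mult l)
  ne_zero : ∀ l w, mult l w ≠ 0
  cocycle : ∀ l l' w, mult (l + l') w = mult l' (w + l) * mult l w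

/-- An isomorphism of holomorphic line bundles over `W / L`: multiplication by a nowhere
vanishing holomorphic function on `W` that carries sections of `e` to sections of `e'`. -/
@[ext]
structure HolIso {W : Type} [NormedAddCommGroup W] [NormedSpace ℂ W] {L : AddSubgroup W}
    (e e' : HolLineBundle W L) where
  toFun : W → ℂ
  holomorphic : Differentiable ℂ toFun
  ne_zero : ∀ w, toFun w ≠ 0
  equivariant : ∀ (l : L) (w : W), toFun (w + l) * e.mult l w = e'.mult l w * toFun w

namespace HolLineBundle

/-- The trivial line bundle. -/
def trivial (W : Type) [NormedAddCommGroup W] [NormedSpace ℂ W] (L : AddSubgroup W) :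
    HolLineBundle W L where
  mult _ _ := 1
  holomorphic _ := differentiable_const _
  ne_zero _ _ := one_ne_zero
  cocycle _ _ _ := by simp

/-- The tensor product of two line bundles. -/
def tensor {W : Type} [NormedAddCommGroup W] [NormedSpace ℂ W] {L : AddSubgroup W}
    (e e' : HolLineBundle W L) : HolLineBundle W L where
  mult l w := e.mult l w * e'.mult l w
  holomorphic l := (e.holomorphic l).mul (e'.holomorphic l)
  ne_zero l w := mul_ne_zero (e.ne_zero l w) (e'.ne_zero l w)
  cocycle l l' w := by rw [e.cocycle, e'.cocycle]; ring

/-- The dual line bundle. -/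
def dual {W : Type} [NormedAddCommGroup W] [NormedSpace ℂ W] {L : AddSubgroup W}
    (e : HolLineBundle W L) : HolLineBundle W L where
  mult l w := (e.mult l w)⁻¹
  holomorphic l := (e.holomorphic l).inv (e.ne_zero l)
  ne_zero l w := inv_ne_zero (e.ne_zero l w)
  cocycle l l' w := by rw [e.cocycle, mul_inv]

/-- The pull-back under the holomorphic map `W / L → W' / L'` induced by a holomorphic map
`F : W → W'` that is equivariant with respect to a homomorphism `f : L → L'`. -/
def pullback {W W' : Type} [NormedAddCommGroup W] [NormedSpace ℂ W] [NormedAddCommGroup W']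
    [NormedSpace ℂ W'] {L : AddSubgroup W} {L' : AddSubgroup W'} (e : HolLineBundle W' L')
    (F : W → W') (hF : Differentiable ℂ F) (f : L →+ L')
    (hFf : ∀ (w : W) (l : L), F (w + l) = F w + f l) : HolLineBundle W L where
  mult l w := e.mult (f l) (F w)
  holomorphic l := (e.holomorphic (f l)).comp hF
  ne_zero l w := e.ne_zero _ _
  cocycle l l' w := by rw [map_add, e.cocycle, hFf]

/-- The pull-back `T_v^* e` under the translation by (the class of) `v`. -/
def translate {W : Type} [NormedAddCommGroup W] [NormedSpace ℂ W] {L : AddSubgroup W}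
    (e : HolLineBundle W L) (v : W) : HolLineBundle W L :=
  e.pullback (fun w => w + v) (differentiable_id.add_const v) (AddMonoidHom.id L)
    (fun w l => add_right_comm w l v)

end HolLineBundle

/-- A Hermitian metric on a holomorphic line bundle: the norm squared of the section `s` is
`h w * ‖s w‖ ^ 2`. -/
structure HermMetric {W : Type} [NormedAddCommGroup W] [NormedSpace ℂ W] {L : AddSubgroup W}
    (e : HolLineBundle W L) where
  toFun : W → ℝ
  smooth : ContDiff ℝ ∞ toFun
  pos : ∀ w, 0 < toFun w
  equivariant : ∀ (l : L) (w : W), toFun (w + l) * ‖e.mult l w‖ ^ 2 = toFun w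

/-- A smooth complex line bundle on a real torus `W / L` with a Hermitian metric and a
compatible (unitary) connection `d + A`, all described on `W`. -/
structure UnitaryLineBundle (W : Type) [NormedAddCommGroup W] [NormedSpace ℝ W]
    (L : AddSubgroup W) where
  mult : L → W → ℂ
  smooth : ∀ l, ContDiff ℝ ∞ (mult l)
  ne_zero : ∀ l w, mult l w ≠ 0
  cocycle : ∀ l l' w, mult (l + l') w = mult l' (w + l) * mult l w
  /-- the metric -/
  metric : W → ℝ
  metric_smooth : ContDiff ℝ ∞ metric
  metric_pos : ∀ w, 0 < metric w
  metric_equivariant : ∀ (l : L) (w : W), metric (w + l) * ‖mult l w‖ ^ 2 = metric w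
  /-- the connection form `A` -/
  conn : W → W →L[ℝ] ℂ
  conn_smooth : ContDiff ℝ ∞ conn
  /-- the operator `d + A` preserves sections -/
  conn_equivariant : ∀ (l : L) (w v : W),
    fderiv ℝ (mult l) w v + conn (w + l) v * mult l w = mult l w * conn w v
  /-- the connection is compatible with the metric -/
  unitary : ∀ w v, fderiv ℝ metric w v = metric w * (2 * (conn w v).re)

/-- The pull-back of a line bundle with its metric and connection under the map of tori induced
by a real linear map. -/
def UnitaryLineBundle.pullback {W W' : Type} [NormedAddCommGroup W] [NormedSpace ℝ W]
    [NormedAddCommGroup W'] [NormedSpace ℝ W'] {L : AddSubgroup W} {L' : AddSubgroup W'}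
    (E : UnitaryLineBundle W' L') (F : W →L[ℝ] W') (hF : ∀ l ∈ L, F l ∈ L') :
    UnitaryLineBundle W L where
  mult l w := E.mult ⟨F l, hF l l.2⟩ (F w)
  smooth l := (E.smooth _).comp F.contDiff
  ne_zero l w := E.ne_zero _ _
  cocycle l l' w := by
    have h : (⟨F (l + l' : L), hF _ (l + l').2⟩ : L') = ⟨F l, hF l l.2⟩ + ⟨F l', hF l' l'.2⟩ :=
      Subtype.ext (by simp)
    rw [h, E.cocycle, map_add]
  metric w := E.metric (F w)
  metric_smooth := E.metric_smooth.comp F.contDiff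
  metric_pos w := E.metric_pos _
  metric_equivariant l w := by
    have h := E.metric_equivariant ⟨F l, hF l l.2⟩ (F w)
    rw [map_add]; exact h
  conn w := (E.conn (F w)).comp F
  conn_smooth := (E.conn_smooth.comp F.contDiff).clm_comp contDiff_const
  conn_equivariant l w v := by
    have h := E.conn_equivariant ⟨F l, hF l l.2⟩ (F w) (F v)
    have hd : DifferentiableAt ℝ (E.mult ⟨F l, hF l l.2⟩) (F w) :=
      ((E.smooth _).differentiable (by simp)) _
    have hc : fderiv ℝ (fun w => E.mult ⟨F l, hF l l.2⟩ (F w)) w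
        = (fderiv ℝ (E.mult ⟨F l, hF l l.2⟩) (F w)).comp F :=
      (hd.hasFDerivAt.comp w F.hasFDerivAt).fderiv
    rw [hc, map_add]; exact h
  unitary w v := by
    have hd : DifferentiableAt ℝ E.metric (F w) := (E.metric_smooth.differentiable (by simp)) _
    have hc : fderiv ℝ (fun w => E.metric (F w)) w = (fderiv ℝ E.metric (F w)).comp F :=
      (hd.hasFDerivAt.comp w F.hasFDerivAt).fderiv
    rw [hc]; exact E.unitary (F w) (F v)

/-! ## Types of forms, curvature -/

/-- The `(0,1)`-part of a complex valued real 1-form at a point. -/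
def part01 {W : Type} [NormedAddCommGroup W] [NormedSpace ℂ W] (a : W →L[ℝ] ℂ) : W →L[ℝ] ℂ :=
  (1 / 2 : ℂ) • (a + Complex.I • a.comp ((Complex.I • ContinuousLinearMap.id ℂ W).restrictScalars ℝ))

/-- The curvature 2-form `dA` (`A ∧ A = 0` in rank one) of the connection `d + A`. -/
def curvature {W : Type} [NormedAddCommGroup W] [NormedSpace ℝ W] (A : W → W →L[ℝ] ℂ) :
    W → W [⋀^Fin 2]→L[ℝ] ℂ :=
  extDeriv fun w => ContinuousAlternatingMap.ofSubsingleton ℝ W ℂ (0 : Fin 1) (A w)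

/-- The curvature `-∂∂̄ log h` of a Hermitian metric `h` on a holomorphic line bundle. Here
`∂∂̄ = d∂̄`, as `∂̄∂̄ = 0`. -/
def HermMetric.curvature {W : Type} [NormedAddCommGroup W] [NormedSpace ℂ W] {L : AddSubgroup W}
    {e : HolLineBundle W L} (h : HermMetric e) : W → W [⋀^Fin 2]→L[ℝ] ℂ :=
  fun w => -PoincareTorus.curvature
    (fun w => part01 (fderiv ℝ (fun w' => ((Real.log (h.toFun w') : ℝ) : ℂ)) w)) w

/-- An isomorphism from a holomorphic line bundle `e` to a line bundle `E` with connection, where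
`E` carries the holomorphic structure whose `∂̄`-operator is the `(0,1)`-part of the connection:
multiplication by a nowhere vanishing smooth function `u` that carries sections of `e` to sections
of `E` and holomorphic sections to sections killed by `∂̄ + A^{0,1}`, that is
`∂̄u + A^{0,1} u = 0`. -/
@[ext]
structure HolIsoToConn {W : Type} [NormedAddCommGroup W] [NormedSpace ℂ W] {L : AddSubgroup W}
    (e : HolLineBundle W L) (E : UnitaryLineBundle W L) where
  toFun : W → ℂ
  smooth : ContDiff ℝ ∞ toFun
  ne_zero : ∀ w, toFun w ≠ 0
  equivariant : ∀ (l : L) (w : W), toFun (w + l) * e.mult l w = E.mult l w * toFun w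
  dbar : ∀ w, part01 (fderiv ℝ toFun w) + toFun w • part01 (E.conn w) = 0

/-- The metric of `E`, transported to `e`. -/
def HolIsoToConn.metric {W : Type} [NormedAddCommGroup W] [NormedSpace ℂ W] {L : AddSubgroup W}
    {e : HolLineBundle W L} {E : UnitaryLineBundle W L} (Ψ : HolIsoToConn e E) :
    HermMetric e where
  toFun w := E.metric w * ‖Ψ.toFun w‖ ^ 2
  smooth := E.metric_smooth.mul (Ψ.smooth.norm_sq ℝ)
  pos w := mul_pos (E.metric_pos w) (pow_pos (norm_pos_iff.2 (Ψ.ne_zero w)) 2)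
  equivariant l w := by
    have h := congrArg (fun x : ℂ => ‖x‖ ^ 2) (Ψ.equivariant l w)
    simp only [norm_mul, mul_pow] at h
    rw [mul_assoc, h, ← mul_assoc, E.metric_equivariant]

/-- The connection form of the connection of `E`, transported to `e`: `A + u⁻¹ du`. -/
def HolIsoToConn.conn {W : Type} [NormedAddCommGroup W] [NormedSpace ℂ W] {L : AddSubgroup W}
    {e : HolLineBundle W L} {E : UnitaryLineBundle W L} (Ψ : HolIsoToConn e E) :
    W → W →L[ℝ] ℂ :=
  fun w => E.conn w + (Ψ.toFun w)⁻¹ • fderiv ℝ Ψ.toFun w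

/-! ## The tori -/

/-- The lattice `Λ = ℤ δ + ℤ τ` in `V = ℂ`; the complex torus is `M = ℂ ⧸ Λ`. -/
def lattice (δ : ℕ) (τ : UpperHalfPlane) : AddSubgroup ℂ :=
  AddSubgroup.closure {(δ : ℂ), (τ : ℂ)}

/-- The space of conjugate linear functionals on `V`, that is of the forms `σ dz̄`. -/
abbrev ConjDual : Type := ℂ →L⋆[ℂ] ℂ

/-- The dual lattice in the space of conjugate linear functionals: the conjugate linear parts of
the real forms that are integral on `Λ`, that is the conjugate linear functionals whose real part
is half-integral on `Λ`. The dual torus is `M̂ = ConjDual ⧸ conjDualLattice δ τ`. -/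
def conjDualLattice (δ : ℕ) (τ : UpperHalfPlane) : AddSubgroup ConjDual where
  carrier := {α | ∀ l ∈ lattice δ τ, ∃ n : ℤ, 2 * (α l).re = n}
  zero_mem' l _ := ⟨0, by simp⟩
  add_mem' {α β} hα hβ l hl := by
    obtain ⟨m, hm⟩ := hα l hl
    obtain ⟨n, hn⟩ := hβ l hl
    exact ⟨m + n, by push_cast; rw [← hm, ← hn]; simp; ring⟩
  neg_mem' {α} hα l hl := by
    obtain ⟨m, hm⟩ := hα l hl
    exact ⟨-m, by push_cast; rw [← hm]; simp⟩

/-- The lattice `2πΛ*` in the real dual `V* = Hom(V, ℝ)`, where `Λ*` consists of the forms that are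
integral on `Λ`. The torus `M*` is the quotient by it. -/
def realDualLattice (δ : ℕ) (τ : UpperHalfPlane) : AddSubgroup (ℂ →L[ℝ] ℝ) where
  carrier := {ξ | ∀ l ∈ lattice δ τ, ∃ n : ℤ, ξ l = 2 * Real.pi * n}
  zero_mem' l _ := ⟨0, by simp⟩
  add_mem' {α β} hα hβ l hl := by
    obtain ⟨m, hm⟩ := hα l hl
    obtain ⟨n, hn⟩ := hβ l hl
    exact ⟨m + n, by push_cast; change α l + β l = _; rw [hm, hn]; ring⟩
  neg_mem' {α} hα l hl := by
    obtain ⟨m, hm⟩ := hα l hl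
    exact ⟨-m, by push_cast; change -α l = _; rw [hm]; ring⟩

/-! ## The line bundles -/

/-- The coordinate `n` of `l = mδ + nτ`. -/
def tauCoord (τ : UpperHalfPlane) (l : ℂ) : ℝ := l.im / τ.im

theorem exists_int (δ : ℕ) (τ : UpperHalfPlane) (l : ℂ) (hl : l ∈ lattice δ τ) :
    ∃ m n : ℤ, tauCoord τ l = n ∧ l = m * δ + n * τ := by
  have hτ : τ.im ≠ 0 := τ.im_pos.ne'
  have h : ∃ m n : ℤ, l = m * δ + n * τ := by
    obtain ⟨m, n, h⟩ := AddSubgroup.mem_closure_pair.1 hl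
    exact ⟨m, n, by rw [← h]; simp⟩
  obtain ⟨m, n, h⟩ := h
  refine ⟨m, n, ?_, h⟩
  have hi : l.im = n * τ.im := by rw [h]; simp
  rw [tauCoord, hi, mul_div_assoc, div_self hτ, mul_one]

theorem tauCoord_add (τ : UpperHalfPlane) (l l' : ℂ) :
    tauCoord τ (l + l') = tauCoord τ l + tauCoord τ l' := by
  simp [tauCoord, add_div]

/-- The line bundle `L₀` on `M`: its multipliers are `1` for `δ` and `exp (-2πiz - πiτ)` for `τ`,
hence `exp (-2πinz - πin²τ)` for `mδ + nτ`. -/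
def L0 (δ : ℕ) (τ : UpperHalfPlane) : HolLineBundle ℂ (lattice δ τ) where
  mult l z := Complex.exp (-2 * Real.pi * Complex.I * tauCoord τ l * z
    - Real.pi * Complex.I * tauCoord τ l ^ 2 * τ)
  holomorphic l := by fun_prop
  ne_zero l z := Complex.exp_ne_zero _
  cocycle l l' z := by
    obtain ⟨m, n, hn, hl⟩ := exists_int δ τ l l.2
    obtain ⟨m', n', hn', hl'⟩ := exists_int δ τ l' l'.2
    rw [AddSubgroup.coe_add, tauCoord_add, hn, hn', ← Complex.exp_add, Complex.exp_eq_exp_iff_exists_int]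
    refine ⟨n' * m * δ, ?_⟩
    rw [hl]; push_cast; ring

/-- The line bundle `P_α` of degree zero on `M` that corresponds to the class of `α` under
`M̂ ≅ Pic⁰(M)`: it has the constant multipliers `exp (2πi α(l))`. -/
def degZero (δ : ℕ) (τ : UpperHalfPlane) (α : ConjDual) : HolLineBundle ℂ (lattice δ τ) where
  mult l _ := Complex.exp (2 * Real.pi * Complex.I * α l)
  holomorphic l := differentiable_const _
  ne_zero l z := Complex.exp_ne_zero _
  cocycle l l' z := by
    rw [← Complex.exp_add, AddSubgroup.coe_add, map_add]; ring_nf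

/-- `φ : M → M̂` is the map `φ_{L₀}`: under `M̂ ≅ Pic⁰(M)`, the point `φ [μ]` is the isomorphism
class of `T_μ^* L₀ ⊗ L₀^*`. -/
def IsPhi (δ : ℕ) (τ : UpperHalfPlane) (φ : ℂ ⧸ lattice δ τ → ConjDual ⧸ conjDualLattice δ τ) :
    Prop :=
  ∀ (μ : ℂ) (α : ConjDual), φ (QuotientAddGroup.mk μ) = QuotientAddGroup.mk α →
    Nonempty (HolIso (degZero δ τ α) (((L0 δ τ).translate μ).tensor (L0 δ τ).dual))

/-- `ρ : V → ConjDual` is a complex linear lift of the map `φ : M → M̂`. -/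
def IsLift (δ : ℕ) (τ : UpperHalfPlane) (φ : ℂ ⧸ lattice δ τ → ConjDual ⧸ conjDualLattice δ τ)
    (ρ : ℂ →L[ℂ] ConjDual) : Prop :=
  ∀ μ : ℂ, φ (QuotientAddGroup.mk μ) = QuotientAddGroup.mk (ρ μ)

theorem IsLift.mem {δ : ℕ} {τ : UpperHalfPlane}
    {φ : ℂ ⧸ lattice δ τ → ConjDual ⧸ conjDualLattice δ τ} {ρ : ℂ →L[ℂ] ConjDual}
    (h : IsLift δ τ φ ρ) {l : ℂ} (hl : l ∈ lattice δ τ) : ρ l ∈ conjDualLattice δ τ := by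
  have h0 := h 0
  have h1 := h l
  rw [(QuotientAddGroup.eq_zero_iff l).2 hl] at h1
  rw [QuotientAddGroup.mk_zero, map_zero, QuotientAddGroup.mk_zero] at h0
  rw [h0] at h1
  exact (QuotientAddGroup.eq_zero_iff _).1 h1.symm

/-- The lattice of `M × M̂`. -/
abbrev prodLattice (δ : ℕ) (τ : UpperHalfPlane) : AddSubgroup (ℂ × ConjDual) :=
  (lattice δ τ).prod (conjDualLattice δ τ)

/-- The restriction to `M × {[α]}` of a line bundle on `M × M̂`. -/
def restrictLeft {δ : ℕ} {τ : UpperHalfPlane} (P : HolLineBundle (ℂ × ConjDual) (prodLattice δ τ))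
    (α : ConjDual) : HolLineBundle ℂ (lattice δ τ) :=
  P.pullback (fun z => (z, α)) (differentiable_id.prodMk (differentiable_const α))
    { toFun := fun l => ⟨(l, 0), AddSubgroup.mem_prod.2 ⟨l.2, zero_mem _⟩⟩
      map_zero' := rfl
      map_add' := fun l l' => Subtype.ext (by simp) }
    (fun z l => by simp)

/-- The restriction to `{0} × M̂` of a line bundle on `M × M̂`. -/
def restrictZero {δ : ℕ} {τ : UpperHalfPlane} (P : HolLineBundle (ℂ × ConjDual) (prodLattice δ τ)) :
    HolLineBundle ConjDual (conjDualLattice δ τ) :=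
  P.pullback (fun α => (0, α)) ((differentiable_const 0).prodMk differentiable_id)
    { toFun := fun l => ⟨(0, l), AddSubgroup.mem_prod.2 ⟨zero_mem _, l.2⟩⟩
      map_zero' := rfl
      map_add' := fun l l' => Subtype.ext (by simp) }
    (fun z l => by simp)

/-- `P` is the Poincaré line bundle on `M × M̂`: its restriction to `M × {[α]}` is isomorphic to
`P_α`, and its restriction to `{0} × M̂` is trivial. -/
def IsPoincare {δ : ℕ} {τ : UpperHalfPlane} (P : HolLineBundle (ℂ × ConjDual) (prodLattice δ τ)) :
    Prop :=
  (∀ α, Nonempty (HolIso (restrictLeft P α) (degZero δ τ α))) ∧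
    Nonempty (HolIso (HolLineBundle.trivial _ _) (restrictZero P))

/-- The line bundle on `M × M*` that is the quotient of the trivial bundle over `M × V*` by the
action `2πν ∘ (x, ξ, σ) = (x, ξ + 2πν, exp (-2πi ν(x)) σ)` of `2πΛ*`, with the metric induced by
`σ₁ σ̄₂` and the connection induced by `d + iξ`. -/
def calP (δ : ℕ) (τ : UpperHalfPlane) :
    UnitaryLineBundle (ℂ × (ℂ →L[ℝ] ℝ)) ((lattice δ τ).prod (realDualLattice δ τ)) where
  mult l w := Complex.exp (-Complex.I * (l.1.2 w.1 : ℝ))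
  smooth l := by
    have h : ContDiff ℝ ∞ (fun w : ℂ × (ℂ →L[ℝ] ℝ) => ((l.1.2 w.1 : ℝ) : ℂ)) :=
      Complex.ofRealCLM.contDiff.comp (l.1.2.contDiff.comp contDiff_fst)
    exact (contDiff_const.mul h).cexp
  ne_zero l w := Complex.exp_ne_zero _
  cocycle l l' w := by
    obtain ⟨n, hn⟩ := l'.2.2 l.1.1 l.2.1
    rw [← Complex.exp_add, Complex.exp_eq_exp_iff_exists_int]
    refine ⟨n, ?_⟩
    have h1 : (l'.1.2 (w + l).1 : ℝ) = l'.1.2 w.1 + 2 * Real.pi * n := by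
      rw [Prod.fst_add, map_add, hn]
    have h2 : ((l + l').1.2 w.1 : ℝ) = l.1.2 w.1 + l'.1.2 w.1 := by
      simp
    rw [h1, h2]; push_cast; ring
  metric _ := 1
  metric_smooth := contDiff_const
  metric_pos _ := one_pos
  metric_equivariant l w := by
    have h : -Complex.I * ((l.1.2 w.1 : ℝ) : ℂ) = ((-(l.1.2 w.1) : ℝ) : ℂ) * Complex.I := by
      push_cast; ring
    rw [h, Complex.norm_exp_ofReal_mul_I]; norm_num
  conn w := Complex.I • Complex.ofRealCLM.comp (w.2.comp (ContinuousLinearMap.fst ℝ _ _))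
  conn_smooth := by fun_prop
  conn_equivariant l w v := by
    have h : HasFDerivAt (fun w : ℂ × (ℂ →L[ℝ] ℝ) => -Complex.I * ((l.1.2 w.1 : ℝ) : ℂ))
        ((-Complex.I) • Complex.ofRealCLM.comp (l.1.2.comp (ContinuousLinearMap.fst ℝ _ _))) w :=
      ((Complex.ofRealCLM.comp
        (l.1.2.comp (ContinuousLinearMap.fst ℝ _ _))).hasFDerivAt (x := w)).const_mul (-Complex.I)
    rw [h.cexp.fderiv]
    simp
    ring
  unitary w v := by simp

/-- The real linear map that covers `Iso : M̂ → M*`; it sends the conjugate linear part of a real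
form `dx` to `2π dx`, that is `α` to `2π (α + ᾱ) = 4π Re α`. -/
def isoCover : ConjDual →L[ℝ] (ℂ →L[ℝ] ℝ) :=
  LinearMap.mkContinuous₂
    (LinearMap.mk₂ ℝ (fun (α : ConjDual) (z : ℂ) => 4 * Real.pi * (α z).re)
      (fun α β z => by simp; ring) (fun c α z => by simp; ring)
      (fun α z w => by simp; ring)
      (fun c α z => by
        have h : c • z = (c : ℂ) • z := by simp
        rw [h, map_smulₛₗ]; simp; ring))
    (4 * Real.pi) (fun α z => by
      simp only [LinearMap.mk₂_apply, norm_mul, Real.norm_eq_abs, abs_of_pos Real.pi_pos]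
      have h1 : |(α z).re| ≤ ‖α‖ * ‖z‖ := (Complex.abs_re_le_norm _).trans (α.le_opNorm z)
      have h2 := mul_le_mul_of_nonneg_left h1 (by positivity : 0 ≤ 4 * Real.pi)
      simpa [mul_assoc] using h2)

/-- The map `Id × Iso` on the covers. -/
def idIso : ℂ × ConjDual →L[ℝ] ℂ × (ℂ →L[ℝ] ℝ) := (ContinuousLinearMap.id ℝ ℂ).prodMap isoCover

theorem isoCover_apply (α : ConjDual) (z : ℂ) : isoCover α z = 4 * Real.pi * (α z).re := rfl

theorem idIso_mem (δ : ℕ) (τ : UpperHalfPlane) :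
    ∀ l ∈ prodLattice δ τ, idIso l ∈ (lattice δ τ).prod (realDualLattice δ τ) := by
  rintro ⟨l, α⟩ ⟨hl, hα⟩
  refine ⟨hl, fun l' hl' => ?_⟩
  obtain ⟨n, hn⟩ := hα l' hl'
  refine ⟨n, ?_⟩
  change isoCover α l' = _
  rw [isoCover_apply, ← hn]
  ring

/-- The pull-back of `calP`, with its metric and connection, to `M × M̂` by `Id × Iso`. -/
def isoCalP (δ : ℕ) (τ : UpperHalfPlane) : UnitaryLineBundle (ℂ × ConjDual) (prodLattice δ τ) :=
  (calP δ τ).pullback idIso (idIso_mem δ τ)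

/-! ## Pull-back to `M × M` -/

/-- The lattice of `M × M`. -/
abbrev sqLattice (δ : ℕ) (τ : UpperHalfPlane) : AddSubgroup (ℂ × ℂ) :=
  (lattice δ τ).prod (lattice δ τ)

/-- The map `Id × ρ` on the covers. -/
def idProd (ρ : ℂ →L[ℂ] ConjDual) : ℂ × ℂ →L[ℂ] ℂ × ConjDual :=
  (ContinuousLinearMap.id ℂ ℂ).prodMap ρ

/-- The pull-back `(Id × φ)^* P` of a holomorphic line bundle on `M × M̂` to `M × M`. -/
def pullIdPhi {δ : ℕ} {τ : UpperHalfPlane}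
    {φ : ℂ ⧸ lattice δ τ → ConjDual ⧸ conjDualLattice δ τ} {ρ : ℂ →L[ℂ] ConjDual}
    (hρ : IsLift δ τ φ ρ) (P : HolLineBundle (ℂ × ConjDual) (prodLattice δ τ)) :
    HolLineBundle (ℂ × ℂ) (sqLattice δ τ) :=
  P.pullback (idProd ρ) (idProd ρ).differentiable
    { toFun := fun l => ⟨idProd ρ l, AddSubgroup.mem_prod.2 ⟨l.2.1, hρ.mem l.2.2⟩⟩
      map_zero' := Subtype.ext (by simp)
      map_add' := fun l l' => Subtype.ext (by simp) }
    (fun w l => by simp)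

/-- The pull-back of a 2-form under `Id × φ`. -/
def pullForm (ρ : ℂ →L[ℂ] ConjDual) (Θ : ℂ × ConjDual → (ℂ × ConjDual) [⋀^Fin 2]→L[ℝ] ℂ) :
    ℂ × ℂ → (ℂ × ℂ) [⋀^Fin 2]→L[ℝ] ℂ :=
  fun w => (Θ (idProd ρ w)).compContinuousLinearMap ((idProd ρ).restrictScalars ℝ)

/-- The line bundle on `M × M` with the multipliers `1`, `exp (-2πiμ)` for `(δ, 0)`, `(τ, 0)` and
`1`, `exp (-2πiz)` for `(0, δ)`, `(0, τ)`. -/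
def J (δ : ℕ) (τ : UpperHalfPlane) : HolLineBundle (ℂ × ℂ) (sqLattice δ τ) where
  mult l w := Complex.exp (-2 * Real.pi * Complex.I *
    (tauCoord τ l.1.1 * w.2 + tauCoord τ l.1.2 * w.1 + tauCoord τ l.1.1 * tauCoord τ l.1.2 * τ))
  holomorphic l := by fun_prop
  ne_zero l z := Complex.exp_ne_zero _
  cocycle l l' w := by
    obtain ⟨m₁, n₁, hn₁, hl₁⟩ := exists_int δ τ l.1.1 l.2.1
    obtain ⟨m₂, n₂, hn₂, hl₂⟩ := exists_int δ τ l.1.2 l.2.2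
    obtain ⟨m₁', n₁', hn₁', hl₁'⟩ := exists_int δ τ l'.1.1 l'.2.1
    obtain ⟨m₂', n₂', hn₂', hl₂'⟩ := exists_int δ τ l'.1.2 l'.2.2
    rw [AddSubgroup.coe_add, Prod.fst_add, Prod.snd_add, tauCoord_add, tauCoord_add,
      hn₁, hn₂, hn₁', hn₂', ← Complex.exp_add, Complex.exp_eq_exp_iff_exists_int]
    refine ⟨n₁' * m₂ * δ + n₂' * m₁ * δ, ?_⟩
    rw [Prod.fst_add, Prod.snd_add, hl₁, hl₂]; push_cast; ring

/-- The pull-back `π₁^* L₀` to `M × M`. -/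
def L0fst (δ : ℕ) (τ : UpperHalfPlane) : HolLineBundle (ℂ × ℂ) (sqLattice δ τ) :=
  (L0 δ τ).pullback Prod.fst differentiable_fst
    { toFun := fun l => ⟨l.1.1, l.2.1⟩
      map_zero' := rfl
      map_add' := fun _ _ => rfl }
    (fun _ _ => rfl)

/-- The pull-back `π₂^* L₀` to `M × M`. -/
def L0snd (δ : ℕ) (τ : UpperHalfPlane) : HolLineBundle (ℂ × ℂ) (sqLattice δ τ) :=
  (L0 δ τ).pullback Prod.snd differentiable_snd
    { toFun := fun l => ⟨l.1.2, l.2.2⟩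
      map_zero' := rfl
      map_add' := fun _ _ => rfl }
    (fun _ _ => rfl)

/-- The line bundle `K̃ = π₁^* L₀ ⊗ J ⊗ π₂^* L₀` on `M × M`. -/
def Ktilde (δ : ℕ) (τ : UpperHalfPlane) : HolLineBundle (ℂ × ℂ) (sqLattice δ τ) :=
  ((L0fst δ τ).tensor (J δ τ)).tensor (L0snd δ τ)

theorem normSq_exp (w : ℂ) : ‖Complex.exp w‖ ^ 2 = Real.exp (2 * w.re) := by
  rw [Complex.norm_exp, ← Real.exp_nat_mul]; norm_num

/-- The metric `exp (-2π z₂² / τ₂)` on `L₀`. -/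
def hL0 (δ : ℕ) (τ : UpperHalfPlane) : HermMetric (L0 δ τ) where
  toFun z := Real.exp (-2 * Real.pi / τ.im * z.im ^ 2)
  smooth := (contDiff_const.mul (Complex.imCLM.contDiff.pow 2)).exp
  pos z := Real.exp_pos _
  equivariant l z := by
    obtain ⟨m, n, hn, hl⟩ := exists_int δ τ l l.2
    have hτ : τ.im ≠ 0 := τ.im_pos.ne'
    have hi : (z + l).im = z.im + n * τ.im := by rw [hl]; simp
    simp only [L0]
    rw [normSq_exp, ← Real.exp_add, hn, hi]
    congr 1
    simp [pow_two]
    field_simp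
    ring

/-- The metric `exp (-2π (z₂ + μ₂)² / τ₂)` on `K̃`. -/
def hK (δ : ℕ) (τ : UpperHalfPlane) : HermMetric (Ktilde δ τ) where
  toFun w := Real.exp (-2 * Real.pi / τ.im * (w.1.im + w.2.im) ^ 2)
  smooth := (contDiff_const.mul (((Complex.imCLM.contDiff.comp contDiff_fst).add
    (Complex.imCLM.contDiff.comp contDiff_snd)).pow 2)).exp
  pos w := Real.exp_pos _
  equivariant l w := by
    obtain ⟨m, n, hn, hl⟩ := exists_int δ τ l.1.1 l.2.1
    obtain ⟨m', n', hn', hl'⟩ := exists_int δ τ l.1.2 l.2.2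
    have hτ : τ.im ≠ 0 := τ.im_pos.ne'
    have hi : (w + l).1.im = w.1.im + n * τ.im := by rw [Prod.fst_add, hl]; simp
    have hi' : (w + l).2.im = w.2.im + n' * τ.im := by rw [Prod.snd_add, hl']; simp
    simp only [Ktilde, HolLineBundle.tensor, L0fst, L0snd, HolLineBundle.pullback, J, L0,
      AddMonoidHom.coe_mk, ZeroHom.coe_mk]
    rw [← Complex.exp_add, ← Complex.exp_add, normSq_exp, ← Real.exp_add, hn, hn', hi, hi']
    congr 1
    simp [pow_two]
    field_simp
    ring

/-- The metric on `J` that is induced by those on `K̃ = π₁^* L₀ ⊗ J ⊗ π₂^* L₀` and on `L₀`. -/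
def hJ (δ : ℕ) (τ : UpperHalfPlane) : HermMetric (J δ τ) where
  toFun w := (hK δ τ).toFun w / ((hL0 δ τ).toFun w.1 * (hL0 δ τ).toFun w.2)
  smooth := (hK δ τ).smooth.div
    (((hL0 δ τ).smooth.comp contDiff_fst).mul ((hL0 δ τ).smooth.comp contDiff_snd))
    (fun w => (mul_pos ((hL0 δ τ).pos _) ((hL0 δ τ).pos _)).ne')
  pos w := div_pos ((hK δ τ).pos _) (mul_pos ((hL0 δ τ).pos _) ((hL0 δ τ).pos _))
  equivariant l w := by
    have hk := (hK δ τ).equivariant l w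
    have h1 := (hL0 δ τ).equivariant ⟨l.1.1, l.2.1⟩ w.1
    have h2 := (hL0 δ τ).equivariant ⟨l.1.2, l.2.2⟩ w.2
    have p1 := ((hL0 δ τ).pos (w + l).1).ne'
    have p2 := ((hL0 δ τ).pos (w + l).2).ne'
    have q1 : ‖(L0 δ τ).mult ⟨l.1.1, l.2.1⟩ w.1‖ ≠ 0 := norm_ne_zero_iff.2 ((L0 δ τ).ne_zero _ _)
    have q2 : ‖(L0 δ τ).mult ⟨l.1.2, l.2.2⟩ w.2‖ ≠ 0 := norm_ne_zero_iff.2 ((L0 δ τ).ne_zero _ _)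
    have hm : (Ktilde δ τ).mult l w = (L0 δ τ).mult ⟨l.1.1, l.2.1⟩ w.1 * (J δ τ).mult l w
      * (L0 δ τ).mult ⟨l.1.2, l.2.2⟩ w.2 := rfl
    rw [hm, norm_mul, norm_mul] at hk
    rw [← hk, ← h1, ← h2]
    simp only [Prod.fst_add, Prod.snd_add] at p1 p2 ⊢
    field_simp

/-- The value `(a ∧ b)(u, v)` for two 1-forms `a`, `b` at a point. -/
def wedge {W : Type} (a b : W → ℂ) (u v : W) : ℂ := a u * b v - a v * b u

end PoincareTorus

end

/-! Everything reduces to explicit exponentials on the universal covers, once every Poincaré bundle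
is known to be isomorphic to one explicit model.

The lift of `φ` is α = -iμ/(2τ₂) dz̄. Indeed T_μ^*L₀ ⊗ L₀^* has the multiplier exp(-2πinμ) at l = mδ
+ nτ, with n = (l - l̄)/(2iτ₂). The part of the exponent linear in l is removed by the gauge factor
exp(-πμz/τ₂), and the part in l̄ is 2πiα(l) (`translateIso`). That `φ` has no other value follows
from Liouville: if P_α ≅ P_β, a linear exponential twists the isomorphism into an entire function of
periodic modulus, hence a constant (`mem_conjDualLattice_of_holIso`). The linear lift is unique
because the dual lattice contains no complex line.

The model `poincareBundle` is mapped to the pull-back of `calP` by exp(-2πiα(z)) and, after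
pull-back by Id × `φ`, to `J` by exp(-πzμ/τ₂). A general Poincaré bundle only comes with unrelated
isomorphisms P|_{M×[α]} ≅ P_α, one for each α. Normalized at z = 0 they become unique, and the main
analytic point, `IsCobounded.differentiable_of_slices`, is that they then depend holomorphically on
α. This gives `exists_holIso_poincareBundle`, compatible with the trivialization t. Uniqueness of Ψ
and Φ is again Liouville: the quotient of two candidates is entire and periodic along M and equals 1
over 0 (`eq_of_eq_on_zero`).

For the theorem itself, curvature does not depend on the trivialization, so both curvatures are
constant forms that can be compared directly. In the comparison of metrics the isomorphism from P to
the model enters both sides through the same factor, and Re(μz̄) - Re(μz) = 2z₂μ₂ remains. -/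

noncomputable section

namespace PoincareTorus

/-! ## Smoothness of holomorphic functions of several variables -/

section Holomorphic

open MeasureTheory Metric Set Filter Topology

variable {E : Type*} [NormedAddCommGroup E] [NormedSpace ℂ E]

/-- Cauchy's formula for a directional derivative. -/
theorem fderiv_apply_eq_integral {F : E → ℂ} (hF : Differentiable ℂ F) (x v : E) :
    fderiv ℂ F x v = (2 * Real.pi * Complex.I : ℂ)⁻¹ * ∫ θ in (0 : ℝ)..2 * Real.pi,
      (deriv (circleMap 0 1) θ * ((circleMap 0 1 θ) ^ 2)⁻¹) * F (x + circleMap 0 1 θ • v) := by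
  have hl : Differentiable ℂ fun ζ : ℂ => F (x + ζ • v) := by fun_prop
  have h := Complex.two_pi_I_inv_smul_circleIntegral_sub_sq_inv_smul_of_differentiable
    (U := univ) isOpen_univ (c := 0) (w₀ := 0) (R := 1) (subset_univ _) hl.differentiableOn
    (mem_ball_self one_pos)
  have hd : deriv (fun ζ : ℂ => F (x + ζ • v)) 0 = fderiv ℂ F x v := by
    have h1 : HasDerivAt (fun ζ : ℂ => x + ζ • v) v 0 := by
      simpa using ((hasDerivAt_id (0 : ℂ)).smul_const v).const_add x
    have h2 : HasFDerivAt F (fderiv ℂ F x) (x + (0 : ℂ) • v) := by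
      simpa using (hF x).hasFDerivAt
    exact (h2.comp_hasDerivAt (0 : ℂ) h1).deriv
  rw [← hd, ← h, smul_eq_mul, circleIntegral]
  congr 1
  refine intervalIntegral.integral_congr fun θ _ => ?_
  simp [mul_assoc]

theorem continuous_circle_kernel :
    Continuous fun θ : ℝ => deriv (circleMap 0 1) θ * ((circleMap 0 1 θ) ^ 2)⁻¹ := by
  have h : ∀ θ : ℝ, (circleMap 0 1 θ) ^ 2 ≠ 0 := fun θ =>
    pow_ne_zero _ (circleMap_ne_center one_ne_zero)
  simp only [deriv_circleMap]
  exact ((continuous_circleMap 0 1).mul continuous_const).mul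
    (((continuous_circleMap 0 1).pow 2).inv₀ h)

variable [FiniteDimensional ℂ E]

/-- Cauchy's formula writes each directional derivative as an integral of F itself over a compact
circle, so continuity of F passes to it; finite dimension reduces the operator norm to directional
derivatives. -/
theorem continuous_fderiv_of_differentiable {F : E → ℂ} (hF : Differentiable ℂ F) :
    Continuous (fderiv ℂ F) := by
  rw [continuous_clm_apply]
  intro v
  simp only [fderiv_apply_eq_integral hF]
  refine continuous_const.mul ?_
  refine intervalIntegral.continuous_parametric_intervalIntegral_of_continuous'
    (f := fun x θ => (deriv (circleMap 0 1) θ * ((circleMap 0 1 θ) ^ 2)⁻¹)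
      * F (x + circleMap 0 1 θ • v)) ?_ _ _
  refine (continuous_circle_kernel.comp continuous_snd).mul (hF.continuous.comp ?_)
  exact continuous_fst.add (((continuous_circleMap 0 1).comp continuous_snd).smul continuous_const)

/-- Differentiation under the integral sign in Cauchy's formula. The dominating constant comes from
compactness of the unit ball times the circle parameter, using that the derivative is already known
to be continuous. -/
theorem differentiable_fderiv_apply {F : E → ℂ} (hF : Differentiable ℂ F) (v : E) :
    Differentiable ℂ fun x => fderiv ℂ F x v := by
  have := FiniteDimensional.proper ℂ E
  intro x₀
  simp only [fderiv_apply_eq_integral hF]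
  refine DifferentiableAt.const_mul ?_ _
  have hp : Continuous fun p : E × ℝ => p.1 + circleMap 0 1 p.2 • v :=
    continuous_fst.add (((continuous_circleMap 0 1).comp continuous_snd).smul continuous_const)
  have hK : Continuous fun p : E × ℝ => (deriv (circleMap 0 1) p.2 * ((circleMap 0 1 p.2) ^ 2)⁻¹)
      * F (p.1 + circleMap 0 1 p.2 • v) :=
    (continuous_circle_kernel.comp continuous_snd).mul (hF.continuous.comp hp)
  have hK' : Continuous fun p : E × ℝ =>
      (deriv (circleMap 0 1) p.2 * ((circleMap 0 1 p.2) ^ 2)⁻¹)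
      • fderiv ℂ F (p.1 + circleMap 0 1 p.2 • v) :=
    (continuous_circle_kernel.comp continuous_snd).smul
      ((continuous_fderiv_of_differentiable hF).comp hp)
  obtain ⟨C, hC⟩ := ((isCompact_closedBall x₀ 1).prod
    (isCompact_uIcc (a := (0 : ℝ)) (b := 2 * Real.pi))).exists_bound_of_continuousOn
    hK'.continuousOn
  refine (intervalIntegral.hasFDerivAt_integral_of_dominated_of_fderiv_le
    (F := fun (x : E) (θ : ℝ) => (deriv (circleMap 0 1) θ * ((circleMap 0 1 θ) ^ 2)⁻¹)
      * F (x + circleMap 0 1 θ • v))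
    (F' := fun (x : E) (θ : ℝ) => (deriv (circleMap 0 1) θ * ((circleMap 0 1 θ) ^ 2)⁻¹)
      • fderiv ℂ F (x + circleMap 0 1 θ • v))
    (closedBall_mem_nhds x₀ one_pos) ?_ ?_ ?_ (bound := fun _ => C) ?_ ?_ ?_).differentiableAt
  · exact Eventually.of_forall fun x =>
      (hK.comp (continuous_const.prodMk continuous_id)).aestronglyMeasurable
  · exact (hK.comp (continuous_const.prodMk continuous_id)).intervalIntegrable _ _
  · exact (hK'.comp (continuous_const.prodMk continuous_id)).aestronglyMeasurable
  · exact ae_of_all _ fun θ hθ x hx => hC (x, θ) ⟨hx, uIoc_subset_uIcc hθ⟩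
  · exact intervalIntegrable_const
  · refine ae_of_all _ fun θ _ x _ => ?_
    have h2 := (hF (x + circleMap 0 1 θ • v)).hasFDerivAt.comp x
      ((hasFDerivAt_id x).add_const (circleMap 0 1 θ • v))
    rw [ContinuousLinearMap.comp_id] at h2
    exact h2.const_mul _

theorem contDiff_of_differentiable {F : E → ℂ} (hF : Differentiable ℂ F) : ContDiff ℂ ∞ F := by
  rw [contDiff_infty]
  intro n
  induction n generalizing F with
  | zero => exact contDiff_zero.2 hF.continuous
  | succ n ih =>
    push_cast
    rw [contDiff_succ_iff_fderiv_apply]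
    exact ⟨hF, by simp, fun y => ih (differentiable_fderiv_apply hF y)⟩

theorem contDiff_real_of_differentiable {F : E → ℂ} (hF : Differentiable ℂ F) :
    ContDiff ℝ ∞ F :=
  letI := NormedSpace.complexToReal (E := E)
  (contDiff_of_differentiable hF).restrict_scalars ℝ

end Holomorphic

/-! ## Holomorphic dependence of theta functions on a parameter -/

section Dependence

open Metric Set Filter Topology

/-- A quantitative Liouville theorem: an entire function that vanishes at `0` and whose values on
a disc are controlled by those on the concentric disc of half the radius is small. -/
theorem norm_le_of_half_disc {f : ℂ → ℂ} (hf : Differentiable ℂ f) (h0 : f 0 = 0) {r a b : ℝ}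
    (hr : 0 < r) (ha : 0 ≤ a) (ha' : a ≤ 3 / 2) (hb : 0 ≤ b)
    (h : ∀ z ∈ ball (0 : ℂ) (2 * r), ∃ z' ∈ closedBall (0 : ℂ) r, ‖f z‖ ≤ a * ‖f z'‖ + b) :
    ∀ z ∈ ball (0 : ℂ) (2 * r), ‖f z‖ ≤ 4 * b := by
  obtain ⟨z₁, hz₁, hmax⟩ := (isCompact_closedBall (0 : ℂ) r).exists_isMaxOn
    (nonempty_closedBall.2 hr.le) hf.continuous.norm.continuousOn
  have hball : ∀ z ∈ ball (0 : ℂ) (2 * r), ‖f z‖ ≤ a * ‖f z₁‖ + b := by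
    intro z hz
    obtain ⟨z', hz', hle⟩ := h z hz
    have := mul_le_mul_of_nonneg_left (hmax hz') ha
    exact hle.trans (by simpa using this)
  have hz₁r : ‖z₁‖ ≤ r := by simpa using hz₁
  -- By the Schwarz lemma the maximum m on the half disc is at most half the bound on the full disc:
  -- m ≤ (3m/2 + b)/2, so m ≤ 2b. Hence the bound on the full disc is at most 3b + b = 4b.
  have hsch := Complex.dist_le_div_mul_dist_of_mapsTo_ball (f := f) (c := 0) (R₁ := 2 * r)
    (R₂ := a * ‖f z₁‖ + b) (z := z₁) hf.differentiableOn
    (fun z hz => by simpa [h0] using hball z hz) (by simp; linarith)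
  rw [h0, dist_zero_right, dist_zero_right] at hsch
  have hM : 0 ≤ a * ‖f z₁‖ + b := by positivity
  have h1 : (a * ‖f z₁‖ + b) / (2 * r) * ‖z₁‖ ≤ (a * ‖f z₁‖ + b) / (2 * r) * r := by gcongr
  have h2 : (a * ‖f z₁‖ + b) / (2 * r) * r = (a * ‖f z₁‖ + b) / 2 := by field_simp
  have h3 := mul_le_mul_of_nonneg_right ha' (norm_nonneg (f z₁))
  intro z hz
  have := hball z hz
  linarith

/-- First order Taylor formula with integral remainder in the second variable: q(z, h) = c(z, s)⁻¹
∫₀¹ ∂₂c(z, s + th) dt. The point is that q remains continuous at h = 0. -/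
theorem exists_continuous_quotient {c : ℂ × ℂ → ℂ} (hc : Differentiable ℂ c) (hc0 : ∀ w, c w ≠ 0)
    (s : ℂ) : ∃ q : ℂ × ℂ → ℂ, Continuous q ∧
      ∀ z h, c (z, s + h) = c (z, s) * (1 + h * q (z, h)) := by
  have hcf := continuous_fderiv_of_differentiable hc
  refine ⟨fun p => (c (p.1, s))⁻¹ * ∫ t in (0 : ℝ)..1,
    fderiv ℂ c (p.1, s + (t : ℂ) * p.2) (0, 1), ?_, fun z h => ?_⟩
  · refine ((hc.continuous.comp (by fun_prop)).inv₀ fun _ => hc0 _).mul ?_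
    refine intervalIntegral.continuous_parametric_intervalIntegral_of_continuous'
      (f := fun (p : ℂ × ℂ) (t : ℝ) => fderiv ℂ c (p.1, s + (t : ℂ) * p.2) (0, 1)) ?_ _ _
    exact (hcf.comp (by fun_prop : Continuous fun p : (ℂ × ℂ) × ℝ =>
      (p.1.1, s + (p.2 : ℂ) * p.1.2))).clm_apply continuous_const
  · have hd : ∀ t ∈ uIcc (0 : ℝ) 1, HasDerivAt (fun t : ℝ => c (z, s + (t : ℂ) * h))
        (h * fderiv ℂ c (z, s + (t : ℂ) * h) (0, 1)) t := by
      intro t _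
      have h1 : HasDerivAt (fun t : ℝ => ((z, s + (t : ℂ) * h) : ℂ × ℂ)) ((0, h) : ℂ × ℂ) t := by
        refine (hasDerivAt_const t z).prodMk ?_
        simpa using ((Complex.ofRealCLM.hasDerivAt (x := t)).mul_const h).const_add s
      have h2 := ((hc (z, s + (t : ℂ) * h)).hasFDerivAt.restrictScalars ℝ).comp_hasDerivAt t h1
      have h3 : ((0, h) : ℂ × ℂ) = h • ((0, 1) : ℂ × ℂ) := by simp
      have h4 : fderiv ℂ c (z, s + (t : ℂ) * h) (0, h)
          = h * fderiv ℂ c (z, s + (t : ℂ) * h) (0, 1) := by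
        rw [h3, map_smul, smul_eq_mul]
      rw [← h4]
      exact h2
    have hci : Continuous fun t : ℝ => h * fderiv ℂ c (z, s + (t : ℂ) * h) (0, 1) :=
      continuous_const.mul ((hcf.comp (by fun_prop)).clm_apply continuous_const)
    have := intervalIntegral.integral_eq_sub_of_hasDerivAt hd (hci.intervalIntegrable _ _)
    rw [intervalIntegral.integral_const_mul] at this
    have hz := hc0 (z, s)
    field_simp
    simp only [Complex.ofReal_one, one_mul, Complex.ofReal_zero, zero_mul, add_zero] at this
    simp only [mul_comm h]
    rw [mul_comm] at this
    rw [this]; ring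

/-- A function `(s - s₀) E (w)` with `E` continuous at `w₀` is differentiable at `w₀`. -/
theorem differentiableAt_snd_sub_mul {E : ℂ × ℂ → ℂ} {w₀ : ℂ × ℂ} (hE : ContinuousAt E w₀) :
    DifferentiableAt ℂ (fun w : ℂ × ℂ => (w.2 - w₀.2) * E w) w₀ := by
  refine ⟨E w₀ • ContinuousLinearMap.snd ℂ ℂ ℂ, ?_⟩
  rw [hasFDerivAt_iff_isLittleO]
  have h1 : (fun w : ℂ × ℂ => w.2 - w₀.2) =O[𝓝 w₀] fun w => w - w₀ :=
    Asymptotics.isBigO_of_le _ fun w => norm_snd_le (w - w₀)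
  have h2 : (fun w => E w - E w₀) =o[𝓝 w₀] fun _ => (1 : ℝ) := by
    rw [Asymptotics.isLittleO_one_iff]
    simpa using hE.tendsto.sub_const (E w₀)
  have h3 := (h1.norm_right.mul_isLittleO h2)
  simp only [mul_one] at h3
  refine h3.of_norm_right.congr_left fun w => ?_
  simp
  ring

variable {Λ : AddSubgroup ℂ}

/-- `Λ` meets every disc of some fixed radius. -/
def IsCobounded (Λ : AddSubgroup ℂ) : Prop := ∃ r : ℝ, ∀ z : ℂ, ∃ l : Λ, ‖z - l‖ < r

/-- By compactness finitely many periods suffice to move the disc of radius 2r into that of radius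
r. This supplies the comparison needed in `norm_le_of_half_disc`, with constants uniform over a
finite set. -/
theorem IsCobounded.exists_finset (hΛ : IsCobounded Λ) (R : ℝ) : ∃ r, R < r ∧ 0 < r ∧
    ∃ S : Finset Λ, ∀ z ∈ ball (0 : ℂ) (2 * r), ∃ l ∈ S, z - l ∈ closedBall (0 : ℂ) r := by
  obtain ⟨r₀, hr₀⟩ := hΛ
  refine ⟨max (max r₀ (R + 1)) 1, ?_, by positivity, ?_⟩
  · exact (lt_add_one R).trans_le ((le_max_right _ _).trans (le_max_left _ _))
  set r := max (max r₀ (R + 1)) 1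
  have hr : r₀ ≤ r := (le_max_left _ _).trans (le_max_left _ _)
  obtain ⟨S, hS⟩ := (isCompact_closedBall (0 : ℂ) (2 * r)).elim_finite_subcover
    (fun l : Λ => ball (l : ℂ) r) (fun _ => isOpen_ball) fun z _ => by
      obtain ⟨l, hl⟩ := hr₀ z
      exact mem_iUnion.2 ⟨l, by rw [mem_ball, dist_eq_norm]; exact hl.trans_le hr⟩
  refine ⟨S, fun z hz => ?_⟩
  obtain ⟨l, hl, hz'⟩ := mem_iUnion₂.1 (hS (ball_subset_closedBall hz))
  refine ⟨l, hl, ?_⟩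
  rw [mem_ball, dist_eq_norm] at hz'
  simpa using hz'.le

/-- An entire function whose absolute value is `Λ`-periodic is constant. -/
theorem IsCobounded.eq_const (hΛ : IsCobounded Λ) {f : ℂ → ℂ} (hf : Differentiable ℂ f)
    (hper : ∀ (l : Λ) z, ‖f (z + l)‖ = ‖f z‖) (z : ℂ) : f z = f 0 := by
  obtain ⟨r, hr⟩ := hΛ
  obtain ⟨C, hC⟩ := (isCompact_closedBall (0 : ℂ) r).exists_bound_of_continuousOn
    hf.continuous.continuousOn
  refine hf.apply_eq_apply_of_bounded (isBounded_iff_forall_norm_le.2 ⟨C, ?_⟩) z 0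
  rintro _ ⟨w, rfl⟩
  obtain ⟨l, hl⟩ := hr w
  have := hper l (w - l)
  rw [sub_add_cancel] at this
  rw [this]
  exact hC _ (by simpa using hl.le)

/-- Theta functions depend holomorphically on parameters: if the multipliers `c` depend
holomorphically on `s`, and for every `s` the nowhere vanishing entire function `G (·, s)` has the
multipliers `c (·, s)` and is normalized, then `G` is holomorphic. -/
theorem IsCobounded.differentiable_of_slices (hΛ : IsCobounded Λ) {c : Λ → ℂ × ℂ → ℂ}
    (hc : ∀ l, Differentiable ℂ (c l)) (hc0 : ∀ l w, c l w ≠ 0) {G : ℂ × ℂ → ℂ}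
    (hGd : ∀ s, Differentiable ℂ fun z => G (z, s)) (hG0 : ∀ w, G w ≠ 0)
    (hG1 : ∀ s, G (0, s) = 1) (hG : ∀ (l : Λ) z s, G (z + l, s) = c l (z, s) * G (z, s)) :
    Differentiable ℂ G := by
  rintro ⟨z₀, s₀⟩
  obtain ⟨r, hzr, hr, S, hS⟩ := hΛ.exists_finset ‖z₀‖
  choose q hq hcq using fun l => exists_continuous_quotient (hc l) (hc0 l) s₀
  choose C hC using fun l => ((isCompact_closedBall (0 : ℂ) r).prod
    (isCompact_closedBall (0 : ℂ) 1)).exists_bound_of_continuousOn (hq l).continuousOn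
  set Q : ℝ := ∑ l ∈ S, |C l| with hQdef
  have hQ0 : 0 ≤ Q := Finset.sum_nonneg fun _ _ => abs_nonneg _
  have hQ : ∀ l ∈ S, ∀ z ∈ closedBall (0 : ℂ) r, ∀ h : ℂ, ‖h‖ ≤ 1 → ‖q l (z, h)‖ ≤ Q := by
    intro l hl z hz h hh
    refine (hC l (z, h) ⟨hz, by simpa using hh⟩).trans ((le_abs_self _).trans ?_)
    exact Finset.single_le_sum (f := fun l => |C l|) (fun _ _ => abs_nonneg _) hl
  -- D h is the difference quotient at s₀ of s ↦ G(z, s)/G(z, s₀). It is entire in z and vanishes at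
  -- z = 0; the goal is that it converges locally uniformly as h → 0.
  set D : ℂ → ℂ → ℂ := fun h z => (G (z, s₀ + h) / G (z, s₀) - 1) / h with hD
  have hDd : ∀ h, Differentiable ℂ (D h) := fun h =>
    (((hGd _).div (hGd _) fun _ => hG0 _).sub_const _).div_const _
  have hD0 : ∀ h, D h 0 = 0 := fun h => by simp [hD, hG1]
  -- Under a period, D h changes only by terms in q, which are bounded on compact sets. A bound on
  -- the disc of radius r therefore controls D h on the disc of radius 2r with a factor close to 1,
  -- and the Schwarz lemma closes the estimate.
  have hstep : ∀ h ≠ 0, ∀ (l : Λ) z, D h (z + l) = D h z + h * q l (z, h) * D h z + q l (z, h) := by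
    intro h hh l z
    have h1 := hG0 (z, s₀)
    have h2 := hc0 l (z, s₀)
    simp only [hD, hG, hcq]
    field_simp
    ring
  have hbound : ∀ h ≠ 0, ‖h‖ ≤ 1 → ‖h‖ * Q ≤ 1 / 2 → ∀ z ∈ ball (0 : ℂ) (2 * r),
      ‖D h z‖ ≤ 4 * Q := by
    intro h hh hh1 hhQ
    refine norm_le_of_half_disc (hDd h) (hD0 h) hr (a := 1 + ‖h‖ * Q) (by positivity)
      (by linarith) hQ0 fun z hz => ?_
    obtain ⟨l, hl, hz'⟩ := hS z hz
    refine ⟨z - l, hz', ?_⟩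
    have := hstep h hh l (z - l)
    rw [sub_add_cancel] at this
    rw [this]
    have hq' := hQ l hl _ hz' h hh1
    calc _ ≤ ‖D h (z - l)‖ + ‖h‖ * ‖q l (z - l, h)‖ * ‖D h (z - l)‖ + ‖q l (z - l, h)‖ := by
          refine (norm_add₃_le).trans ?_
          rw [norm_mul, norm_mul]
      _ ≤ ‖D h (z - l)‖ + ‖h‖ * Q * ‖D h (z - l)‖ + Q := by gcongr
      _ = _ := by ring
  -- The half-disc estimate is applied again, now to D h - D h' with factor a = 1. The inhomogeneous
  -- term consists of h·q·D h, h'·q·D h' and the difference of the two values of q; each is at most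
  -- ε/13, and 4 · 3 · ε/13 < ε.
  have hcauchy : UniformCauchySeqOn D (𝓝[≠] (0 : ℂ)) (ball 0 (2 * r)) := by
    intro u hu
    obtain ⟨ε, hε, hεu⟩ := Metric.mem_uniformity_dist.1 hu
    have hε' : 0 < ε / 13 := by positivity
    have hsmall : ∀ᶠ h : ℂ in 𝓝[≠] 0, h ≠ 0 ∧ ‖h‖ ≤ 1 ∧ ‖h‖ * Q ≤ 1 / 2 ∧
        ‖h‖ * (Q * (4 * Q)) ≤ ε / 13 := by
      have hlim : ∀ A : ℝ, Tendsto (fun h : ℂ => ‖h‖ * A) (𝓝[≠] 0) (𝓝 0) := fun A => by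
        have : Continuous fun h : ℂ => ‖h‖ * A := by fun_prop
        simpa using (this.tendsto 0).mono_left nhdsWithin_le_nhds
      filter_upwards [self_mem_nhdsWithin, (hlim 1).eventually_le_const one_pos,
        (hlim Q).eventually_le_const (by norm_num : (0 : ℝ) < 1 / 2),
        (hlim _).eventually_le_const hε'] with h h1 h2 h3 h4
      exact ⟨h1, by simpa using h2, h3, h4⟩
    -- The difference of the two values of q vanishes at h = h' = 0, and compactness of the z-disc
    -- makes its smallness uniform in z.
    have hclose : ∀ᶠ p : ℂ × ℂ in 𝓝[≠] 0 ×ˢ 𝓝[≠] 0, ∀ l ∈ S, ∀ z ∈ closedBall (0 : ℂ) r,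
        ‖q l (z, p.1) - q l (z, p.2)‖ < ε / 13 := by
      have : ∀ᶠ p : ℂ × ℂ in 𝓝 (0, 0), ∀ l ∈ S, ∀ z ∈ closedBall (0 : ℂ) r,
          ‖q l (z, p.1) - q l (z, p.2)‖ < ε / 13 := by
        rw [Filter.eventually_all_finset]
        intro l _
        refine (isCompact_closedBall (0 : ℂ) r).eventually_forall_of_forall_eventually fun z _ => ?_
        have hcont : Continuous fun x : (ℂ × ℂ) × ℂ =>
            ‖q l (x.2, x.1.1) - q l (x.2, x.1.2)‖ :=
          (((hq l).comp (by fun_prop)).sub ((hq l).comp (by fun_prop))).norm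
        exact (hcont.tendsto ((0, 0), z)).eventually_lt_const (by simpa using hε')
      rw [nhds_prod_eq] at this
      exact this.filter_mono (Filter.prod_mono nhdsWithin_le_nhds nhdsWithin_le_nhds)
    filter_upwards [hsmall.prod_mk hsmall, hclose] with p hp hpq z hz
    obtain ⟨⟨h1, h2, h3, h4⟩, k1, k2, k3, k4⟩ := hp
    refine hεu ?_
    rw [dist_eq_norm]
    have hX := norm_le_of_half_disc (f := fun z => D p.1 z - D p.2 z) (a := 1) (b := 3 * (ε / 13))
      ((hDd _).sub (hDd _)) (by simp [hD0]) hr zero_le_one (by norm_num) (by positivity) ?_ z hz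
    · refine hX.trans_lt ?_
      linarith
    intro z hz
    obtain ⟨l, hl, hz'⟩ := hS z hz
    refine ⟨z - l, hz', ?_⟩
    have e1 := hstep p.1 h1 l (z - l)
    have e2 := hstep p.2 k1 l (z - l)
    rw [sub_add_cancel] at e1 e2
    have hz'' : z - l ∈ ball (0 : ℂ) (2 * r) := closedBall_subset_ball (by linarith) hz'
    have hterm : ∀ h : ℂ, h ≠ 0 → ‖h‖ ≤ 1 → ‖h‖ * Q ≤ 1 / 2 → ‖h‖ * (Q * (4 * Q)) ≤ ε / 13 →
        ‖h * q l (z - l, h) * D h (z - l)‖ ≤ ε / 13 := by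
      intro h h1 h2 h3 h4
      refine le_trans ?_ h4
      rw [norm_mul, norm_mul, mul_assoc]
      have := hQ l hl _ hz' h h2
      have := hbound h h1 h2 h3 _ hz''
      gcongr
    have t1 := hterm _ h1 h2 h3 h4
    have t2 := hterm _ k1 k2 k3 k4
    have t3 := (hpq l hl _ hz').le
    rw [one_mul, e1, e2]
    calc _ = ‖(D p.1 (z - l) - D p.2 (z - l)) + p.1 * q l (z - l, p.1) * D p.1 (z - l)
          - p.2 * q l (z - l, p.2) * D p.2 (z - l) + (q l (z - l, p.1) - q l (z - l, p.2))‖ := by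
          congr 1; ring
      _ ≤ ‖D p.1 (z - l) - D p.2 (z - l)‖ + ‖p.1 * q l (z - l, p.1) * D p.1 (z - l)‖
          + ‖p.2 * q l (z - l, p.2) * D p.2 (z - l)‖ + ‖q l (z - l, p.1) - q l (z - l, p.2)‖ := by
          refine (norm_add_le _ _).trans (add_le_add_left ?_ _)
          refine (norm_sub_le _ _).trans (add_le_add_left ?_ _)
          exact norm_add_le _ _
      _ ≤ _ := by linarith
  have hlim : ∀ z, ∃ L, z ∈ ball (0 : ℂ) (2 * r) → Tendsto (fun h => D h z) (𝓝[≠] 0) (𝓝 L) := by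
    intro z
    by_cases hz : z ∈ ball (0 : ℂ) (2 * r)
    · obtain ⟨L, hL⟩ := cauchy_iff_exists_le_nhds.1 (hcauchy.cauchy_map hz)
      exact ⟨L, fun _ => hL⟩
    · exact ⟨0, fun h => absurd h hz⟩
  choose L hL using hlim
  have hunif := hcauchy.tendstoUniformlyOn_of_tendsto hL
  have hLc : ContinuousOn L (ball 0 (2 * r)) :=
    hunif.continuousOn (Frequently.of_forall fun h => (hDd h).continuous.continuousOn)
  have hz₀ : z₀ ∈ ball (0 : ℂ) (2 * r) := by
    rw [mem_ball_zero_iff]; linarith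
  classical
  -- E extends the difference quotient across s = s₀ by its limit. Uniform convergence makes E
  -- jointly continuous at (z₀, s₀), and then G = G(·, s₀)(1 + (s - s₀)E) is differentiable there.
  set E : ℂ × ℂ → ℂ := fun w => if w.2 = s₀ then L w.1 else D (w.2 - s₀) w.1 with hE
  have hEc : ContinuousAt E (z₀, s₀) := by
    have hE0 : E (z₀, s₀) = L z₀ := if_pos rfl
    rw [ContinuousAt, hE0, Metric.tendsto_nhds]
    intro ε hε
    have h1 : ∀ᶠ w : ℂ × ℂ in 𝓝 (z₀, s₀), w.1 ∈ ball (0 : ℂ) (2 * r) :=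
      continuousAt_fst.eventually (isOpen_ball.mem_nhds hz₀)
    have h2 : ∀ᶠ w : ℂ × ℂ in 𝓝 (z₀, s₀), dist (L w.1) (L z₀) < ε / 2 :=
      ((hLc.continuousAt (isOpen_ball.mem_nhds hz₀)).tendsto.comp
        (continuousAt_fst (p := (z₀, s₀)))).eventually (ball_mem_nhds _ (half_pos hε))
    have h3 := Metric.tendstoUniformlyOn_iff.1 hunif (ε / 2) (half_pos hε)
    rw [eventually_nhdsWithin_iff] at h3
    have h4 : Tendsto (fun w : ℂ × ℂ => w.2 - s₀) (𝓝 (z₀, s₀)) (𝓝 0) := by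
      have : Continuous fun w : ℂ × ℂ => w.2 - s₀ := by fun_prop
      simpa using this.tendsto (z₀, s₀)
    filter_upwards [h1, h2, h4.eventually h3] with w w1 w2 w3
    by_cases hw : w.2 = s₀
    · simp only [hE, hw, if_true]
      linarith
    · have w4 := w3 (sub_ne_zero.2 hw) w.1 w1
      simp only [hE, hw, if_false]
      rw [dist_comm] at w4
      linarith [dist_triangle (D (w.2 - s₀) w.1) (L w.1) (L z₀)]
  have hGE : G = fun w => G (w.1, s₀) * (1 + (w.2 - s₀) * E w) := by
    funext ⟨z, s⟩
    by_cases hs : s = s₀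
    · simp [hs]
    · have h1 := hG0 (z, s₀)
      have h2 : s - s₀ ≠ 0 := sub_ne_zero.2 hs
      simp only [hE, hs, if_false, hD, add_sub_cancel]
      field_simp
      ring
  rw [hGE]
  refine DifferentiableAt.mul ?_ ((differentiableAt_snd_sub_mul hEc).const_add 1)
  exact ((hGd s₀).comp differentiable_fst) _

end Dependence

/-! ## The lattice and conjugate linear functionals -/

theorem mem_lattice (δ : ℕ) (τ : UpperHalfPlane) (m n : ℤ) :
    (m * δ + n * τ : ℂ) ∈ lattice δ τ :=
  AddSubgroup.mem_closure_pair.2 ⟨m, n, by simp⟩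

theorem natCast_mem_lattice (δ : ℕ) (τ : UpperHalfPlane) : (δ : ℂ) ∈ lattice δ τ :=
  AddSubgroup.subset_closure (by simp)

/-- Integer parts of the real coordinates with respect to δ and τ leave a remainder of norm at most
δ + |τ|; the added 1 makes the inequality strict. -/
theorem isCobounded_lattice {δ : ℕ} (hδ : 0 < δ) (τ : UpperHalfPlane) :
    IsCobounded (lattice δ τ) := by
  refine ⟨δ + ‖(τ : ℂ)‖ + 1, fun z => ?_⟩
  set y : ℝ := z.im / τ.im
  set x : ℝ := (z.re - y * τ.re) / δ
  have hτ : τ.im ≠ 0 := τ.im_pos.ne'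
  have hδ' : (δ : ℝ) ≠ 0 := by positivity
  have hz : z = x * δ + y * τ := by
    apply Complex.ext
    · simp [x]; field_simp; ring
    · simp [y]; field_simp
  refine ⟨⟨_, mem_lattice δ τ ⌊x⌋ ⌊y⌋⟩, ?_⟩
  have h : z - (⌊x⌋ * δ + ⌊y⌋ * τ : ℂ) = (Int.fract x : ℝ) * δ + (Int.fract y : ℝ) * τ := by
    rw [hz, Int.fract, Int.fract]; push_cast; ring
  have h1 : ∀ t : ℝ, ‖((Int.fract t : ℝ) : ℂ)‖ ≤ 1 := fun t => by
    rw [Complex.norm_real, Real.norm_eq_abs, abs_of_nonneg (Int.fract_nonneg t)]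
    exact (Int.fract_lt_one t).le
  rw [h]
  refine (norm_add_le _ _).trans_lt ?_
  rw [norm_mul, norm_mul, Complex.norm_natCast]
  have h2 := mul_le_mul_of_nonneg_right (h1 x) (Nat.cast_nonneg (α := ℝ) δ)
  have h3 := mul_le_mul_of_nonneg_right (h1 y) (norm_nonneg (τ : ℂ))
  linarith

theorem ConjDual.apply_eq (α : ConjDual) (z : ℂ) : α z = α 1 * conj z := by
  have := α.map_smulₛₗ z 1
  rw [smul_eq_mul, mul_one, smul_eq_mul] at this
  rw [this, mul_comm]

/-- Evaluation at `z`. -/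
def evalAt (z : ℂ) : ConjDual →L[ℂ] ℂ := ContinuousLinearMap.apply' ℂ (starRingEnd ℂ) z

@[simp] theorem evalAt_apply (z : ℂ) (α : ConjDual) : evalAt z α = α z := rfl

/-- The conjugate linear functional `σ dz̄`. -/
def conjForm : ℂ →L[ℂ] ConjDual :=
  ContinuousLinearMap.toSpanSingleton ℂ ((starL ℂ : ℂ ≃L⋆[ℂ] ℂ) : ConjDual)

@[simp] theorem conjForm_apply (σ z : ℂ) : conjForm σ z = σ * conj z := rfl

theorem conjForm_one (α : ConjDual) : conjForm (α 1) = α := by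
  refine ContinuousLinearMap.ext fun z => ?_
  rw [conjForm_apply, ← ConjDual.apply_eq]

instance : FiniteDimensional ℂ ConjDual :=
  FiniteDimensional.of_surjective (conjForm : ℂ →ₗ[ℂ] ConjDual) fun α => ⟨α 1, conjForm_one α⟩

theorem mem_conjDualLattice_iff {δ : ℕ} {τ : UpperHalfPlane} {α : ConjDual} :
    α ∈ conjDualLattice δ τ ↔ ∀ l ∈ lattice δ τ, ∃ n : ℤ, α l + conj (α l) = n := by
  refine forall₂_congr fun l _ => exists_congr fun n => ?_
  rw [Complex.add_conj]
  norm_cast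

/-- The integrality condition cannot survive arbitrary complex scaling unless α(δ) = 0, and a
conjugate linear functional on ℂ is determined by its value at δ ≠ 0. -/
theorem eq_zero_of_forall_smul_mem {δ : ℕ} (hδ : 0 < δ) {τ : UpperHalfPlane} {α : ConjDual}
    (h : ∀ c : ℂ, c • α ∈ conjDualLattice δ τ) : α = 0 := by
  have h1 : α δ = 0 := by
    by_contra hne
    -- This scaling gives the value 1/4 at δ, hence twice the real part 1/2, which is not an
    -- integer.
    obtain ⟨n, hn⟩ := mem_conjDualLattice_iff.1 (h ((1 / 4) * (α δ)⁻¹)) δ (natCast_mem_lattice δ τ)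
    have h2 : (((1 / 4) * (α δ)⁻¹) • α) δ = 1 / 4 := by
      rw [smul_apply, smul_eq_mul, mul_assoc, inv_mul_cancel₀ hne, mul_one]
    rw [h2] at hn
    have h3 : (2 * n : ℂ) = 1 := by
      rw [← hn, map_div₀, map_one, map_ofNat]; norm_num
    have h4 : 2 * n = 1 := by exact_mod_cast h3
    omega
  rw [ConjDual.apply_eq, mul_eq_zero] at h1
  have hδ' : (conj (δ : ℂ)) ≠ 0 := by simpa using hδ.ne'
  rw [← conjForm_one α, h1.resolve_right hδ', map_zero]

/-! ## Isomorphisms of line bundles -/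

namespace HolIso

variable {W : Type} [NormedAddCommGroup W] [NormedSpace ℂ W] {L : AddSubgroup W}
  {e e' e'' : HolLineBundle W L}

/-- The inverse of an isomorphism. -/
def symm (f : HolIso e e') : HolIso e' e where
  toFun w := (f.toFun w)⁻¹
  holomorphic := f.holomorphic.inv f.ne_zero
  ne_zero w := inv_ne_zero (f.ne_zero w)
  equivariant l w := by
    have h := f.equivariant l w
    have h1 := f.ne_zero w
    have h2 := f.ne_zero (w + l)
    field_simp
    rw [← h]

/-- The composition of two isomorphisms. -/
def trans (f : HolIso e e') (g : HolIso e' e'') : HolIso e e'' where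
  toFun w := g.toFun w * f.toFun w
  holomorphic := g.holomorphic.mul f.holomorphic
  ne_zero w := mul_ne_zero (g.ne_zero w) (f.ne_zero w)
  equivariant l w := by
    rw [mul_assoc, f.equivariant, ← mul_assoc, g.equivariant]; ring

end HolIso

variable {δ : ℕ} {τ : UpperHalfPlane}

/-- Line bundles of degree zero that define the same point of the dual torus are isomorphic. -/
def degZeroIso {α β : ConjDual} (h : -α + β ∈ conjDualLattice δ τ) :
    HolIso (degZero δ τ α) (degZero δ τ β) where
  -- With γ = β - α, integrality of γ + γ̄ on Λ lets exp(2πiγ(l)) be replaced by exp(-2πi conj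
  -- γ(l)), and conj γ is complex linear, so this is the coboundary of a holomorphic exponential.
  toFun z := Complex.exp (-2 * Real.pi * Complex.I * (conj ((-α + β) 1) * z))
  holomorphic := by fun_prop
  ne_zero z := Complex.exp_ne_zero _
  equivariant l z := by
    obtain ⟨n, hn⟩ := mem_conjDualLattice_iff.1 h l l.2
    have h1 : conj ((-α + β) 1) * l = conj ((-α + β) l) := by
      rw [ConjDual.apply_eq _ (l : ℂ)]; simp
    have h2 : β l = n + α l - conj ((-α + β) l) := by
      rw [← hn, add_apply, neg_apply]; ring
    simp only [degZero]
    rw [← Complex.exp_add, ← Complex.exp_add, Complex.exp_eq_exp_iff_exists_int]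
    refine ⟨-n, ?_⟩
    rw [mul_add (conj _), h1, h2]
    push_cast; ring

/-- With γ = β - α, twisting f by exp(2πi conj γ(z)) turns its multipliers into the unimodular
constants exp(2πi(γ + γ̄)(l)). Liouville makes the twisted function a nonzero constant, so these
multipliers are 1. -/
theorem mem_conjDualLattice_of_holIso (hδ : 0 < δ) {α β : ConjDual}
    (f : HolIso (degZero δ τ α) (degZero δ τ β)) : -α + β ∈ conjDualLattice δ τ := by
  set γ : ConjDual := -α + β with hγ
  set g : ℂ → ℂ := fun z =>
    f.toFun z * Complex.exp (2 * Real.pi * Complex.I * (conj (γ 1) * z)) with hg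
  have hgd : Differentiable ℂ g := by
    have := f.holomorphic
    simp only [hg]
    fun_prop
  have hstep : ∀ (l : lattice δ τ) z, g (z + l)
      = Complex.exp (2 * Real.pi * Complex.I * (γ l + conj (γ l))) * g z := by
    intro l z
    have h := f.equivariant l z
    have h1 : conj (γ 1) * l = conj (γ l) := by
      rw [ConjDual.apply_eq _ (l : ℂ)]; simp
    simp only [degZero] at h
    have h2 : f.toFun (z + l) = Complex.exp (2 * Real.pi * Complex.I * γ l) * f.toFun z := by
      have h3 : Complex.exp (2 * Real.pi * Complex.I * γ l)
          * Complex.exp (2 * Real.pi * Complex.I * α l)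
          = Complex.exp (2 * Real.pi * Complex.I * β l) := by
        rw [← Complex.exp_add, hγ, add_apply, neg_apply]
        ring_nf
      rw [← h3] at h
      have h4 := Complex.exp_ne_zero (2 * Real.pi * Complex.I * α l)
      apply mul_right_cancel₀ h4
      rw [h]; ring
    simp only [hg]
    rw [h2, mul_add (conj _), h1, mul_add, mul_add, Complex.exp_add, Complex.exp_add]
    ring
  have hc := (isCobounded_lattice hδ τ).eq_const hgd fun l z => by
    rw [hstep, norm_mul, Complex.add_conj]
    have : 2 * Real.pi * Complex.I * ((2 * (γ l).re : ℝ) : ℂ)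
        = ((2 * Real.pi * (2 * (γ l).re) : ℝ) : ℂ) * Complex.I := by push_cast; ring
    rw [this, Complex.norm_exp_ofReal_mul_I, one_mul]
  refine mem_conjDualLattice_iff.2 fun l hl => ?_
  have h := hstep ⟨l, hl⟩ 0
  rw [hc] at h
  have hg0 : g 0 ≠ 0 := mul_ne_zero (f.ne_zero _) (Complex.exp_ne_zero _)
  have h1 := mul_right_cancel₀ hg0 ((one_mul _).trans h)
  obtain ⟨n, hn⟩ := Complex.exp_eq_one_iff.1 h1.symm
  refine ⟨n, mul_left_cancel₀ Complex.two_pi_I_ne_zero ?_⟩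
  rw [hn]; ring

/-! ## The map `φ` -/

/-- The complex linear lift `μ ↦ -i μ / (2τ₂) dz̄` of the map `φ`. -/
def phiLift (τ : UpperHalfPlane) : ℂ →L[ℂ] ConjDual := (-Complex.I / (2 * τ.im)) • conjForm

theorem phiLift_apply (μ z : ℂ) :
    phiLift τ μ z = -Complex.I / (2 * τ.im) * (μ * conj z) := by
  simp [phiLift]

theorem conj_eq_sub (z : ℂ) : conj z = z - 2 * z.im * Complex.I := by
  apply Complex.ext <;> simp; ring

theorem im_ne_zero (τ : UpperHalfPlane) : (τ.im : ℂ) ≠ 0 := by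
  exact_mod_cast τ.im_pos.ne'

/-- Twice the real part is Im(l k̄)/τ₂, which for l = mδ + nτ and k = m'δ + n'τ is the integer δ(nm'
- mn'). -/
theorem phiLift_mem {l : ℂ} (hl : l ∈ lattice δ τ) : phiLift τ l ∈ conjDualLattice δ τ := by
  refine mem_conjDualLattice_iff.2 fun k hk => ?_
  obtain ⟨m, n, hn, rfl⟩ := exists_int δ τ l hl
  obtain ⟨m', n', hn', rfl⟩ := exists_int δ τ k hk
  have hτ := im_ne_zero τ
  refine ⟨n * m' * δ - m * n' * δ, ?_⟩
  rw [phiLift_apply]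
  simp only [map_add, map_mul, map_div₀, map_neg, Complex.conj_I, Complex.conj_ofReal,
    map_natCast, map_intCast, Complex.conj_conj, map_ofNat]
  rw [conj_eq_sub (τ : ℂ)]
  push_cast
  simp only [UpperHalfPlane.coe_im]
  field_simp
  ring_nf
  simp only [Complex.I_sq]
  ring

/-- The map `φ`. -/
def phiMap (δ : ℕ) (τ : UpperHalfPlane) : ℂ ⧸ lattice δ τ → ConjDual ⧸ conjDualLattice δ τ :=
  QuotientAddGroup.map (lattice δ τ) (conjDualLattice δ τ) (phiLift τ).toLinearMap.toAddMonoidHom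
    fun l (hl : l ∈ lattice δ τ) => (phiLift_mem hl : phiLift τ l ∈ conjDualLattice δ τ)

theorem phiMap_mk (μ : ℂ) :
    phiMap δ τ (QuotientAddGroup.mk μ) = QuotientAddGroup.mk (phiLift τ μ) := rfl

/-- The isomorphism between `P_α`, `α = -i μ / (2τ₂) dz̄`, and `T_μ^* L₀ ⊗ L₀^*`. -/
def translateIso (δ : ℕ) (τ : UpperHalfPlane) (μ : ℂ) :
    HolIso (degZero δ τ (phiLift τ μ)) (((L0 δ τ).translate μ).tensor (L0 δ τ).dual) where
  toFun z := Complex.exp (-Real.pi / τ.im * (μ * z))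
  holomorphic := by fun_prop
  ne_zero z := Complex.exp_ne_zero _
  equivariant l z := by
    have hτ := im_ne_zero τ
    simp only [degZero, HolLineBundle.tensor, HolLineBundle.dual, HolLineBundle.translate,
      HolLineBundle.pullback, L0, AddMonoidHom.id_apply, phiLift_apply]
    rw [← Complex.exp_neg, ← Complex.exp_add, ← Complex.exp_add, ← Complex.exp_add, conj_eq_sub,
      tauCoord]
    congr 1
    push_cast
    field_simp
    linear_combination
      (τ.im * (2 * μ * Complex.I * (l : ℂ).im - μ * l)) * Complex.I_sq

theorem isPhi_phiMap (δ : ℕ) (τ : UpperHalfPlane) : IsPhi δ τ (phiMap δ τ) := by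
  intro μ α h
  rw [phiMap_mk, eq_comm, QuotientAddGroup.eq] at h
  exact ⟨(degZeroIso h).trans (translateIso δ τ μ)⟩

theorem IsPhi.eq_phiMap (hδ : 0 < δ) {φ : ℂ ⧸ lattice δ τ → ConjDual ⧸ conjDualLattice δ τ}
    (hφ : IsPhi δ τ φ) : φ = phiMap δ τ := by
  funext x
  obtain ⟨μ, rfl⟩ := QuotientAddGroup.mk_surjective x
  obtain ⟨α, hα⟩ := QuotientAddGroup.mk_surjective (φ (QuotientAddGroup.mk μ))
  obtain ⟨f⟩ := hφ μ α hα.symm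
  rw [← hα, phiMap_mk, QuotientAddGroup.eq]
  exact mem_conjDualLattice_of_holIso hδ (f.trans (translateIso δ τ μ).symm)

theorem isLift_phiLift (δ : ℕ) (τ : UpperHalfPlane) : IsLift δ τ (phiMap δ τ) (phiLift τ) :=
  phiMap_mk

/-- The difference of two lifts is complex linear with values in the dual lattice, so each of its
values spans a complex line inside that lattice and must vanish. -/
theorem IsLift.eq_phiLift (hδ : 0 < δ) {ρ : ℂ →L[ℂ] ConjDual}
    (hρ : IsLift δ τ (phiMap δ τ) ρ) : ρ = phiLift τ := by
  have hm : ∀ μ, (phiLift τ - ρ) μ ∈ conjDualLattice δ τ := fun μ => by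
    have := (hρ μ).symm.trans (phiMap_mk μ)
    rw [QuotientAddGroup.eq] at this
    simpa [sub_eq_neg_add] using this
  refine ContinuousLinearMap.ext fun μ => ?_
  have h0 := eq_zero_of_forall_smul_mem hδ (α := (phiLift τ - ρ) μ) fun c => by
    rw [← map_smul]; exact hm _
  exact (sub_eq_zero.1 h0).symm

/-! ## Existence of the Poincaré line bundle -/

theorem conj_apply_eq (β : ConjDual) (z : ℂ) : conj (β z) = conj (β 1) * z := by
  rw [ConjDual.apply_eq]; simp

/-- A Poincaré line bundle. -/
def poincareBundle (δ : ℕ) (τ : UpperHalfPlane) :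
    HolLineBundle (ℂ × ConjDual) (prodLattice δ τ) where
  -- The first term gives the multipliers of P_α. Moving α by a dual lattice vector β uses the gauge
  -- factor exp(-2πi conj β(z)) of `degZeroIso`, holomorphic in z. The two kinds of translation
  -- commute because β(l) + conj β(l) is an integer.
  mult l w := Complex.exp (2 * Real.pi * Complex.I *
    (w.2 l.1.1 + l.1.2 l.1.1 - conj (l.1.2 w.1)))
  holomorphic l := by
    have h1 : Differentiable ℂ fun w : ℂ × ConjDual => w.2 l.1.1 :=
      (evalAt l.1.1).differentiable.comp differentiable_snd
    have h2 : Differentiable ℂ fun w : ℂ × ConjDual => conj (l.1.2 w.1) := by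
      rw [funext fun w : ℂ × ConjDual => conj_apply_eq l.1.2 w.1]
      fun_prop
    exact (((h1.add_const _).sub h2).const_mul _).cexp
  ne_zero l w := Complex.exp_ne_zero _
  cocycle l l' w := by
    obtain ⟨n, hn⟩ := mem_conjDualLattice_iff.1 l'.2.2 l.1.1 l.2.1
    rw [← Complex.exp_add, Complex.exp_eq_exp_iff_exists_int]
    refine ⟨n, ?_⟩
    rw [mul_comm (n : ℂ), ← mul_add, ← mul_add, ← hn]
    congr 1
    simp only [AddSubgroup.coe_add, Prod.fst_add, Prod.snd_add, map_add,
      add_apply]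
    ring

theorem isPoincare_poincareBundle (δ : ℕ) (τ : UpperHalfPlane) :
    IsPoincare (poincareBundle δ τ) := by
  refine ⟨fun α => ⟨⟨fun _ => 1, differentiable_const _, fun _ => one_ne_zero, fun l w => ?_⟩⟩,
    ⟨⟨fun _ => 1, differentiable_const _, fun _ => one_ne_zero, fun l w => ?_⟩⟩⟩
  · simp [restrictLeft, HolLineBundle.pullback, poincareBundle, degZero]
  · simp [restrictZero, HolLineBundle.pullback, poincareBundle, HolLineBundle.trivial]

/-! ## Rigidity of isomorphisms over `M × N` -/

theorem HolLineBundle.mult_comm {W : Type} [NormedAddCommGroup W] [NormedSpace ℂ W]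
    {L : AddSubgroup W} (e : HolLineBundle W L) (a b : L) (w : W) :
    e.mult b (w + a) * e.mult a w = e.mult a (w + b) * e.mult b w := by
  rw [← e.cocycle, ← e.cocycle, add_comm]

section Product

variable {Λ : AddSubgroup ℂ} {E : Type} [NormedAddCommGroup E] {L : AddSubgroup E}

/-- The inclusion of the first lattice. -/
def inclLeft (L : AddSubgroup E) (l : Λ) : Λ.prod L :=
  ⟨(l, 0), AddSubgroup.mem_prod.2 ⟨l.2, zero_mem _⟩⟩

/-- The inclusion of the second lattice. -/
def inclRight (Λ : AddSubgroup ℂ) (β : L) : Λ.prod L :=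
  ⟨(0, β), AddSubgroup.mem_prod.2 ⟨zero_mem _, β.2⟩⟩

@[simp] theorem coe_inclLeft (l : Λ) : (inclLeft L l : ℂ × E) = ((l : ℂ), 0) := rfl

@[simp] theorem coe_inclRight (β : L) : (inclRight Λ β : ℂ × E) = (0, (β : E)) := rfl

theorem add_inclLeft (z : ℂ) (α : E) (l : Λ) :
    ((z, α) + inclLeft L l : ℂ × E) = (z + l, α) := by simp

theorem add_inclRight (z : ℂ) (α : E) (β : L) :
    ((z, α) + inclRight Λ β : ℂ × E) = (z, α + β) := by simp

theorem eq_inclLeft_add_inclRight (l : Λ.prod L) :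
    l = inclLeft L ⟨l.1.1, l.2.1⟩ + inclRight Λ ⟨l.1.2, l.2.2⟩ :=
  Subtype.ext (by simp)

/-- Two nowhere vanishing functions that transform in the same way under `Λ`, whose quotient is
holomorphic along `M`, and which agree over `0`, are equal. -/
theorem eq_of_eq_on_zero {E : Type*} (hΛ : IsCobounded Λ) {f g : ℂ × E → ℂ} {a b : Λ → ℂ × E → ℂ}
    (ha : ∀ l w, a l w ≠ 0) (hg0 : ∀ w, g w ≠ 0)
    (hf : ∀ (l : Λ) z α, f (z + l, α) * a l (z, α) = b l (z, α) * f (z, α))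
    (hg : ∀ (l : Λ) z α, g (z + l, α) * a l (z, α) = b l (z, α) * g (z, α))
    (hd : ∀ α, Differentiable ℂ fun z => f (z, α) / g (z, α))
    (h : ∀ α, f (0, α) = g (0, α)) : f = g := by
  funext ⟨z, α⟩
  have hper : ∀ (l : Λ) z, f (z + l, α) / g (z + l, α) = f (z, α) / g (z, α) := by
    intro l z
    have h1 := ha l (z, α)
    have h2 := hg0 (z, α)
    have h3 := hg0 (z + l, α)
    rw [div_eq_div_iff h3 h2]
    apply mul_right_cancel₀ h1
    linear_combination g (z, α) * hf l z α - f (z, α) * hg l z α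
  have hc := hΛ.eq_const (hd α) (fun l z => by rw [hper]) z
  rw [h α, div_self (hg0 _)] at hc
  exact (div_eq_one_iff_eq (hg0 _)).1 hc

variable [NormedSpace ℂ E]

/-- An isomorphism of line bundles over `M × N` is determined by its values over `0`. -/
theorem HolIso.eq_of_eq_on_zero (hΛ : IsCobounded Λ) {e e' : HolLineBundle (ℂ × E) (Λ.prod L)}
    {f g : HolIso e e'} (h : ∀ α, f.toFun (0, α) = g.toFun (0, α)) : f = g := by
  refine HolIso.ext (PoincareTorus.eq_of_eq_on_zero hΛ
    (a := fun l w => e.mult (inclLeft L l) w) (b := fun l w => e'.mult (inclLeft L l) w)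
    (fun _ _ => e.ne_zero _ _) g.ne_zero (fun l z α => ?_) (fun l z α => ?_)
    (fun α => ?_) h)
  · rw [← add_inclLeft (L := L), f.equivariant]
  · rw [← add_inclLeft (L := L), g.equivariant]
  · have hi : Differentiable ℂ fun z : ℂ => (z, α) := by fun_prop
    exact (f.holomorphic.comp hi).div (g.holomorphic.comp hi) fun z => g.ne_zero _

theorem part01_apply {W : Type} [NormedAddCommGroup W] [NormedSpace ℂ W] (a : W →L[ℝ] ℂ) (v : W) :
    part01 a v = 1 / 2 * (a v + Complex.I * a (Complex.I • v)) := rfl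

/-- Both functions solve ∂̄u + A^{0,1}u = 0, so the connection terms cancel in ∂̄(f/g); evaluation
on the vectors (1, 0) and (i, 0) gives the Cauchy–Riemann equation along M. -/
theorem HolIsoToConn.differentiable_div {e : HolLineBundle (ℂ × E) (Λ.prod L)}
    {F : UnitaryLineBundle (ℂ × E) (Λ.prod L)} (f g : HolIsoToConn e F) (α : E) :
    Differentiable ℂ fun z => f.toFun (z, α) / g.toFun (z, α) := by
  intro z
  have hi : HasFDerivAt (fun z : ℂ => (z, α)) (ContinuousLinearMap.inl ℝ ℂ E) z :=
    hasFDerivAt_prodMk_left z α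
  have hf := ((f.smooth.differentiable (by simp) (z, α)).hasFDerivAt).comp z hi
  have hg := ((g.smooth.differentiable (by simp) (z, α)).hasFDerivAt).comp z hi
  have hinv : HasFDerivAt (fun x : ℂ => x⁻¹) _ (g.toFun (z, α)) :=
    (hasDerivAt_inv (g.ne_zero (z, α))).hasFDerivAt.restrictScalars ℝ
  have hq := hf.mul (hinv.comp z hg)
  rw [differentiableAt_complex_iff_differentiableAt_real]
  refine ⟨hq.differentiableAt, ?_⟩
  have h1 := congrArg (fun a => a ((1, 0) : ℂ × E)) (f.dbar (z, α))
  have h2 := congrArg (fun a => a ((1, 0) : ℂ × E)) (g.dbar (z, α))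
  simp only [add_apply, smul_apply, part01_apply, zero_apply, smul_eq_mul, Prod.smul_mk, mul_one,
    smul_zero] at h1 h2
  have hg0 := g.ne_zero (z, α)
  have hq' : fderiv ℝ (fun z => f.toFun (z, α) * (g.toFun (z, α))⁻¹) z = _ := hq.fderiv
  simp only [div_eq_mul_inv]
  rw [hq']
  simp
  field_simp
  linear_combination (-2 * Complex.I) * (g.toFun (z, α) * h1 - f.toFun (z, α) * h2)
    + (g.toFun (z, α) * fderiv ℝ f.toFun (z, α) (Complex.I, 0)
      - f.toFun (z, α) * fderiv ℝ g.toFun (z, α) (Complex.I, 0)) * Complex.I_sq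

theorem HolIsoToConn.eq_of_eq_on_zero (hΛ : IsCobounded Λ)
    {e : HolLineBundle (ℂ × E) (Λ.prod L)} {F : UnitaryLineBundle (ℂ × E) (Λ.prod L)}
    {f g : HolIsoToConn e F} (h : ∀ α, f.toFun (0, α) = g.toFun (0, α)) : f = g := by
  refine HolIsoToConn.ext (PoincareTorus.eq_of_eq_on_zero hΛ
    (a := fun l w => e.mult (inclLeft L l) w) (b := fun l w => F.mult (inclLeft L l) w)
    (fun _ _ => e.ne_zero _ _) g.ne_zero (fun l z α => ?_) (fun l z α => ?_)
    (fun α => f.differentiable_div g α) h)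
  · rw [← add_inclLeft (L := L), f.equivariant]
  · rw [← add_inclLeft (L := L), g.equivariant]

/-- A nowhere vanishing holomorphic function over `M × N` that is equivariant for `Λ`, and over `0`
also for `L`, is an isomorphism. -/
def HolIso.ofLeft (hΛ : IsCobounded Λ) {e e' : HolLineBundle (ℂ × E) (Λ.prod L)}
    (f : ℂ × E → ℂ) (hf : Differentiable ℂ f) (hf0 : ∀ w, f w ≠ 0)
    (hleft : ∀ (l : Λ) z α, f (z + l, α) * e.mult (inclLeft L l) (z, α)
      = e'.mult (inclLeft L l) (z, α) * f (z, α))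
    (hzero : ∀ (β : L) α, f (0, α + β) * e.mult (inclRight Λ β) (0, α)
      = e'.mult (inclRight Λ β) (0, α) * f (0, α)) : HolIso e e' where
  toFun := f
  holomorphic := hf
  ne_zero := hf0
  equivariant l w := by
    obtain ⟨z, α⟩ := w
    have hright : ∀ (β : L) z α, f (z, α + β) * e.mult (inclRight Λ β) (z, α)
        = e'.mult (inclRight Λ β) (z, α) * f (z, α) := by
      intro β z α
      -- For fixed β both sides of the equivariance identity transform alike under Λ, because
      -- multipliers of commuting translations are compatible (`mult_comm`). They agree over 0,
      -- hence everywhere.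
      refine congrFun (PoincareTorus.eq_of_eq_on_zero hΛ
        (f := fun w => f (w.1, w.2 + β) * e.mult (inclRight Λ β) w)
        (g := fun w => e'.mult (inclRight Λ β) w * f w)
        (a := fun l w => e.mult (inclLeft L l) w)
        (b := fun l w => e'.mult (inclLeft L l) (w.1, w.2 + β))
        (fun _ _ => e.ne_zero _ _) (fun _ => mul_ne_zero (e'.ne_zero _ _) (hf0 _))
        (fun l z α => ?_) (fun l z α => ?_)
        (fun α => ?_) (hzero β)) (z, α)
      · have h1 := e.mult_comm (inclLeft L l) (inclRight Λ β) (z, α)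
        have h2 := hleft l z (α + β)
        rw [add_inclLeft, add_inclRight] at h1
        simp only
        linear_combination f (z + l, α + β) * h1 + e.mult (inclRight Λ β) (z, α) * h2
      · have h1 := e'.mult_comm (inclLeft L l) (inclRight Λ β) (z, α)
        have h2 := hleft l z α
        rw [add_inclLeft, add_inclRight] at h1
        simp only
        linear_combination f (z, α) * h1 + e'.mult (inclRight Λ β) (z + l, α) * h2
      · have hi : Differentiable ℂ fun z : ℂ => (z, α) := by fun_prop
        have hi' : Differentiable ℂ fun z : ℂ => (z, α + β) := by fun_prop
        exact ((hf.comp hi').mul ((e.holomorphic _).comp hi)).div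
          (((e'.holomorphic _).comp hi).mul (hf.comp hi))
          fun _ => mul_ne_zero (e'.ne_zero _ _) (hf0 _)
    obtain ⟨a, b, rfl⟩ : ∃ a b, l = inclLeft L a + inclRight Λ b :=
      ⟨_, _, eq_inclLeft_add_inclRight l⟩
    rw [e.cocycle, e'.cocycle, AddSubgroup.coe_add, ← add_assoc, add_inclLeft, add_inclRight]
    have h1 := hright b (z + a) α
    have h2 := hleft a z α
    linear_combination e.mult (inclLeft L a) (z, α) * h1 + e'.mult (inclRight Λ b) (z + a, α) * h2

end Product

/-! ## Uniqueness of the Poincaré line bundle -/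

/-- A see-saw argument. The isomorphisms P|_{M×[α]} ≅ P_α, chosen independently for each α, are
normalized to 1 at z = 0, which forces holomorphic dependence on α. Dividing by t gives equivariance
over {0} × M̂, and `HolIso.ofLeft` propagates it to the whole product. -/
theorem exists_holIso_poincareBundle (hδ : 0 < δ)
    {P : HolLineBundle (ℂ × ConjDual) (prodLattice δ τ)} (hP : IsPoincare P)
    (t : HolIso (HolLineBundle.trivial ConjDual (conjDualLattice δ τ)) (restrictZero P)) :
    ∃ f : HolIso P (poincareBundle δ τ), ∀ α, f.toFun (0, α) * t.toFun α = 1 := by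
  have hΛ := isCobounded_lattice hδ τ
  have u := fun α => (hP.1 α).some
  have hu : ∀ α (l : lattice δ τ) (z : ℂ),
      (u α).toFun (z + l) * P.mult (inclLeft (conjDualLattice δ τ) l) (z, α)
        = Complex.exp (2 * Real.pi * Complex.I * α l) * (u α).toFun z :=
    fun α => (u α).equivariant
  -- The parameter α = s dz̄ is replaced by its coordinate s = α(1), so that
  -- `differentiable_of_slices` applies on ℂ × ℂ.
  set G : ℂ × ℂ → ℂ := fun w => (u (conjForm w.2)).toFun w.1 / (u (conjForm w.2)).toFun 0 with hG
  have hi : Differentiable ℂ fun w : ℂ × ℂ => (w.1, conjForm w.2) :=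
    differentiable_fst.prodMk (conjForm.differentiable.comp differentiable_snd)
  have hGd : Differentiable ℂ G := by
    refine hΛ.differentiable_of_slices (c := fun l w =>
      Complex.exp (2 * Real.pi * Complex.I * conjForm w.2 l)
        / P.mult (inclLeft (conjDualLattice δ τ) l) (w.1, conjForm w.2))
      (fun l => ?_) (fun l w => ?_) (fun s => ?_) (fun w => ?_) (fun s => ?_) (fun l z s => ?_)
    · have h1 : Differentiable ℂ fun w : ℂ × ℂ =>
          P.mult (inclLeft (conjDualLattice δ τ) l) (w.1, conjForm w.2) :=
        (P.holomorphic _).comp hi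
      simp only [div_eq_mul_inv]
      refine Differentiable.mul ?_ (h1.inv fun _ => P.ne_zero _ _)
      simp only [conjForm_apply]
      fun_prop
    · exact div_ne_zero (Complex.exp_ne_zero _) (P.ne_zero _ _)
    · exact (u (conjForm s)).holomorphic.div_const ((u (conjForm s)).toFun 0)
    · exact div_ne_zero ((u _).ne_zero _) ((u _).ne_zero _)
    · exact div_self ((u _).ne_zero _)
    · have h1 := hu (conjForm s) l z
      have h2 := P.ne_zero (inclLeft (conjDualLattice δ τ) l) (z, conjForm s)
      have h3 := (u (conjForm s)).ne_zero 0
      simp only [hG]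
      field_simp
      rw [h1]
  have hGu : ∀ z α, G (z, α 1) = (u α).toFun z / (u α).toFun 0 := fun z α => by
    simp only [hG]
    rw [conjForm_one]
  have ht : ∀ (β : conjDualLattice δ τ) α,
      t.toFun (α + β) * 1 = P.mult (inclRight (lattice δ τ) β) (0, α) * t.toFun α :=
    t.equivariant
  have hG0 : ∀ α : ConjDual, G (0, α 1) = 1 := fun α => by
    rw [hGu, div_self ((u α).ne_zero 0)]
  refine ⟨HolIso.ofLeft hΛ (fun w => G (w.1, w.2 1) / t.toFun w.2) ?_ ?_ ?_ ?_, fun α => ?_⟩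
  · have hi : Differentiable ℂ fun w : ℂ × ConjDual => (w.1, w.2 1) :=
      differentiable_fst.prodMk ((evalAt 1).differentiable.comp differentiable_snd)
    have h1 : Differentiable ℂ fun w : ℂ × ConjDual => t.toFun w.2 :=
      t.holomorphic.comp differentiable_snd
    simp only [div_eq_mul_inv]
    exact (hGd.comp hi).mul (h1.inv fun _ => t.ne_zero _)
  · intro w
    simp only [hGu]
    exact div_ne_zero (div_ne_zero ((u _).ne_zero _) ((u _).ne_zero _)) (t.ne_zero _)
  · intro l z α
    have h1 := hu α l z
    have h2 := t.ne_zero α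
    have h3 := (u α).ne_zero 0
    have h4 : (poincareBundle δ τ).mult (inclLeft (conjDualLattice δ τ) l) (z, α)
        = Complex.exp (2 * Real.pi * Complex.I * α l) := by
      simp [poincareBundle]
    simp only [hGu, h4]
    field_simp
    rw [h1]
  · intro β α
    have h1 := ht β α
    have h2 := t.ne_zero α
    have h3 := t.ne_zero (α + β)
    have h4 : (poincareBundle δ τ).mult (inclRight (lattice δ τ) β) (0, α) = 1 := by
      simp [poincareBundle]
    simp only [hG0, h4]
    field_simp
    rw [← h1, mul_one]
  · change G (0, α 1) / t.toFun α * t.toFun α = 1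
    rw [hG0, one_div, inv_mul_cancel₀ (t.ne_zero α)]

/-! ## The identifications `Ψ` and `Φ` -/

theorem part01_eq_zero {W : Type} [NormedAddCommGroup W] [NormedSpace ℂ W] (a : W →L[ℂ] ℂ) :
    part01 (a.restrictScalars ℝ) = 0 := by
  refine ContinuousLinearMap.ext fun v => ?_
  rw [part01_apply]
  simp [← mul_assoc]

/-- The composition of an isomorphism of holomorphic line bundles with an isomorphism to a line
bundle with connection. -/
def HolIso.toConn {W : Type} [NormedAddCommGroup W] [NormedSpace ℂ W] [FiniteDimensional ℂ W]
    {L : AddSubgroup W} {e e' : HolLineBundle W L} {E : UnitaryLineBundle W L}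
    (f : HolIso e e') (g : HolIsoToConn e' E) : HolIsoToConn e E where
  toFun w := g.toFun w * f.toFun w
  smooth := g.smooth.mul (contDiff_real_of_differentiable f.holomorphic)
  ne_zero w := mul_ne_zero (g.ne_zero w) (f.ne_zero w)
  equivariant l w := by
    rw [mul_assoc, f.equivariant, ← mul_assoc, g.equivariant, mul_assoc]
  dbar w := by
    have hg := (g.smooth.differentiable (by simp) w).hasFDerivAt
    have hf := ((f.holomorphic w).hasFDerivAt.restrictScalars ℝ)
    have h : fderiv ℝ (fun w => g.toFun w * f.toFun w) w = _ := (hg.mul hf).fderiv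
    rw [h]
    refine ContinuousLinearMap.ext fun v => ?_
    have h1 := congrArg (fun a => a v) (g.dbar w)
    have h2 := congrArg (fun a => a v) (part01_eq_zero (fderiv ℂ f.toFun w))
    simp only [add_apply, smul_apply, part01_apply, zero_apply, smul_eq_mul] at h1 h2 ⊢
    linear_combination f.toFun w * h1 + g.toFun w * h2

theorem hasFDerivAt_pairing (w : ℂ × ConjDual) :
    HasFDerivAt (fun w : ℂ × ConjDual => w.2 w.1)
      (w.2 1 • (Complex.conjCLE : ℂ →L[ℝ] ℂ).comp (ContinuousLinearMap.fst ℝ ℂ ConjDual)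
        + conj w.1 • ((evalAt 1).restrictScalars ℝ).comp (ContinuousLinearMap.snd ℝ ℂ ConjDual))
      w := by
  have h : (fun w : ℂ × ConjDual => w.2 w.1) = fun w => w.2 1 * conj w.1 :=
    funext fun w => ConjDual.apply_eq _ _
  rw [h]
  exact (((evalAt 1).restrictScalars ℝ).comp
      (ContinuousLinearMap.snd ℝ ℂ ConjDual)).hasFDerivAt.mul
    ((Complex.conjCLE : ℂ →L[ℝ] ℂ).comp (ContinuousLinearMap.fst ℝ ℂ ConjDual)).hasFDerivAt

theorem contDiff_pairing : ContDiff ℝ ∞ fun w : ℂ × ConjDual => w.2 w.1 := by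
  have h : (fun w : ℂ × ConjDual => w.2 w.1) = fun w => w.2 1 * conj w.1 :=
    funext fun w => ConjDual.apply_eq _ _
  rw [h]
  exact (((evalAt 1).restrictScalars ℝ).comp (ContinuousLinearMap.snd ℝ ℂ ConjDual)).contDiff.mul
    ((Complex.conjCLE : ℂ →L[ℝ] ℂ).comp (ContinuousLinearMap.fst ℝ ℂ ConjDual)).contDiff

theorem isoCalP_conn_apply (w v : ℂ × ConjDual) :
    (isoCalP δ τ).conn w v = Complex.I * ((4 * Real.pi * (w.2 v.1).re : ℝ) : ℂ) := rfl

theorem isoCalP_mult (l : prodLattice δ τ) (w : ℂ × ConjDual) :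
    (isoCalP δ τ).mult l w
      = Complex.exp (-Complex.I * ((4 * Real.pi * (l.1.2 w.1).re : ℝ) : ℂ)) := rfl

/-- The isomorphism between the explicit Poincaré line bundle and the pull-back of `calP`. -/
def poincareIsoConn (δ : ℕ) (τ : UpperHalfPlane) :
    HolIsoToConn (poincareBundle δ τ) (isoCalP δ τ) where
  -- The connection form is 2πi(α + ᾱ), whose (0,1)-part is 2πiα. Since α(z) = α(1)z̄ is complex
  -- linear in α, its (0,1)-differential is α(1)dz̄, and this exponential solves ∂̄u = -A^{0,1}u.
  toFun w := Complex.exp (-2 * Real.pi * Complex.I * w.2 w.1)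
  smooth := (contDiff_const.mul contDiff_pairing).cexp
  ne_zero w := Complex.exp_ne_zero _
  equivariant l w := by
    rw [isoCalP_mult, poincareBundle, ← Complex.exp_add, ← Complex.exp_add]
    congr 1
    have h := Complex.add_conj (l.1.2 w.1)
    push_cast at h ⊢
    simp only [Prod.fst_add, Prod.snd_add, map_add, add_apply]
    linear_combination (-2 * Real.pi * Complex.I) * h
  dbar w := by
    have h := ((hasFDerivAt_pairing w).const_mul (-2 * Real.pi * Complex.I : ℂ)).cexp.fderiv
    rw [h]
    refine ContinuousLinearMap.ext fun v => ?_
    simp only [add_apply, smul_apply, part01_apply, zero_apply, smul_eq_mul, isoCalP_conn_apply,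
      Prod.smul_fst]
    have h1 : w.2 (Complex.I * v.1) = -Complex.I * w.2 v.1 := by
      rw [← smul_eq_mul, map_smulₛₗ]; simp
    have h2 := Complex.re_add_im (w.2 v.1)
    have h3 : w.2 v.1 = w.2 1 * conj v.1 := ConjDual.apply_eq _ _
    rw [h1]
    simp
    linear_combination Complex.exp (-(2 * Real.pi * Complex.I * w.2 w.1)) * (
      2 * Real.pi * Complex.I * h2 + 2 * Real.pi * Complex.I * h3
      + Real.pi * Complex.I * (w.2 1 * conj v.1 - conj w.1 * v.2 1) * Complex.I_sq)

theorem two_pi_I_mul_phiLift (μ z : ℂ) :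
    2 * Real.pi * Complex.I * phiLift τ μ z = Real.pi / τ.im * (μ * conj z) := by
  have hτ := im_ne_zero τ
  rw [phiLift_apply]
  field_simp
  linear_combination (-μ * conj z) * Complex.I_sq

theorem two_pi_I_mul_conj_phiLift (μ z : ℂ) :
    2 * Real.pi * Complex.I * conj (phiLift τ μ z) = -(Real.pi / τ.im * (conj μ * z)) := by
  have h := congrArg conj (two_pi_I_mul_phiLift (τ := τ) μ z)
  simp only [map_mul, map_div₀, Complex.conj_I, Complex.conj_ofReal, Complex.conj_conj,
    map_ofNat] at h
  linear_combination -h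

/-- The isomorphism between the pull-back of the explicit Poincaré line bundle and `J`. -/
def poincareIsoJ (hρ : IsLift δ τ (phiMap δ τ) (phiLift τ)) :
    HolIso (pullIdPhi hρ (poincareBundle δ τ)) (J δ τ) where
  -- Substituting l̄ = l - 2inτ₂ in the pulled-back multipliers leaves the increment of πzμ/τ₂ plus
  -- the exponent of `J`, up to 2πi times an integer. The gauge factor removes that increment.
  toFun w := Complex.exp (-Real.pi / τ.im * (w.1 * w.2))
  holomorphic := by fun_prop
  ne_zero w := Complex.exp_ne_zero _
  equivariant l w := by
    obtain ⟨m, n, hn, hl⟩ := exists_int δ τ l.1.2 l.2.2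
    obtain ⟨m', n', hn', hl'⟩ := exists_int δ τ l.1.1 l.2.1
    have hτ := im_ne_zero τ
    have hm : (pullIdPhi hρ (poincareBundle δ τ)).mult l w
        = Complex.exp (2 * Real.pi * Complex.I * (phiLift τ w.2 l.1.1 + phiLift τ l.1.2 l.1.1
          - conj (phiLift τ l.1.2 w.1))) := rfl
    have h1 : conj l.1.1 = l.1.1 - 2 * (n' * τ.im) * Complex.I := by
      rw [conj_eq_sub, hl']; simp
    have h2 : conj l.1.2 = l.1.2 - 2 * (n * τ.im) * Complex.I := by
      rw [conj_eq_sub, hl]; simp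
    have hπ : (Real.pi / τ.im : ℂ) * τ.im = Real.pi := div_mul_cancel₀ _ hτ
    rw [hm, J, ← Complex.exp_add, ← Complex.exp_add, Complex.exp_eq_exp_iff_exists_int]
    refine ⟨-n' * m * δ, ?_⟩
    rw [mul_sub, mul_add, two_pi_I_mul_phiLift, two_pi_I_mul_phiLift, two_pi_I_mul_conj_phiLift,
      hn, hn', h1, h2, Prod.fst_add, Prod.snd_add]
    push_cast
    linear_combination (-2 * Complex.I * (n' * (w.2 + l.1.2) + n * w.1)) * hπ
      - 2 * Real.pi * Complex.I * n' * hl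

/-- The pull-back of an isomorphism under `Id × φ`. -/
def HolIso.pullIdPhi {φ : ℂ ⧸ lattice δ τ → ConjDual ⧸ conjDualLattice δ τ}
    {ρ : ℂ →L[ℂ] ConjDual} (hρ : IsLift δ τ φ ρ)
    {P P' : HolLineBundle (ℂ × ConjDual) (prodLattice δ τ)} (f : HolIso P P') :
    HolIso (pullIdPhi hρ P) (PoincareTorus.pullIdPhi hρ P') where
  toFun w := f.toFun (idProd ρ w)
  holomorphic := f.holomorphic.comp (idProd ρ).differentiable
  ne_zero _ := f.ne_zero _
  equivariant l w := by
    have h := f.equivariant ⟨idProd ρ l, AddSubgroup.mem_prod.2 ⟨l.2.1, hρ.mem l.2.2⟩⟩ (idProd ρ w)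
    rw [map_add]
    exact h

/-! ## Curvature -/

section Curvature

variable {W : Type} [NormedAddCommGroup W]

theorem curvature_apply [NormedSpace ℝ W] {A : W → W →L[ℝ] ℂ} {w : W}
    (hA : DifferentiableAt ℝ A w) (u v : W) :
    curvature A w ![u, v]
      = fderiv ℝ (fun w => A w v) w u - fderiv ℝ (fun w => A w u) w v := by
  have hd : DifferentiableAt ℝ
      (fun w => ContinuousAlternatingMap.ofSubsingleton ℝ W ℂ (0 : Fin 1) (A w)) w :=
    (ContinuousAlternatingMap.ofSubsingletonLIE (𝕜 := ℝ) (E := W) (F := ℂ)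
      (0 : Fin 1)).differentiableAt.comp w hA
  rw [curvature, extDeriv_apply hd, Fin.sum_univ_two]
  simp [Fin.removeNth, sub_eq_add_neg]

theorem alternatingMap_ext [NormedSpace ℝ W] {a b : W [⋀^Fin 2]→L[ℝ] ℂ}
    (h : ∀ u v, a ![u, v] = b ![u, v]) : a = b := by
  ext x
  have hx : x = ![x 0, x 1] := by
    funext i
    fin_cases i <;> rfl
  rw [hx, h]

/-- Changing the trivialization does not change the curvature. -/
theorem HolIsoToConn.curvature_conn [NormedSpace ℂ W] {L : AddSubgroup W}
    {e : HolLineBundle W L} {E : UnitaryLineBundle W L} (Ψ : HolIsoToConn e E) :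
    curvature Ψ.conn = curvature E.conn := by
  funext w
  have hE := E.conn_smooth.differentiable (by simp) w
  have hu := Ψ.smooth.differentiable (by simp) w
  have hdu : DifferentiableAt ℝ (fderiv ℝ Ψ.toFun) w :=
    (Ψ.smooth.fderiv_right (m := ∞) (by simp)).differentiable (by simp) w
  have hinv : DifferentiableAt ℝ (fun w => (Ψ.toFun w)⁻¹) w := hu.inv (Ψ.ne_zero w)
  have hB : DifferentiableAt ℝ (fun w => (Ψ.toFun w)⁻¹ • fderiv ℝ Ψ.toFun w) w := hinv.smul hdu
  -- The added term u⁻¹du is closed: the second derivative of u is symmetric, and the derivative of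
  -- u⁻¹ contributes a multiple of du ∧ du = 0.
  have hsymm : IsSymmSndFDerivAt ℝ Ψ.toFun w :=
    Ψ.smooth.contDiffAt.isSymmSndFDerivAt (by
      rw [minSmoothness_of_isRCLikeNormedField]; exact WithTop.coe_le_coe.2 le_top)
  have happly : ∀ u v : W, fderiv ℝ (fun w => Ψ.conn w v) w u
      = fderiv ℝ (fun w => E.conn w v) w u + ((Ψ.toFun w)⁻¹ * fderiv ℝ (fderiv ℝ Ψ.toFun) w u v
        + fderiv ℝ (fun w => (Ψ.toFun w)⁻¹) w u * fderiv ℝ Ψ.toFun w v) := by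
    intro u v
    have h1 : HasFDerivAt (fun w => fderiv ℝ Ψ.toFun w v) _ w :=
      hdu.hasFDerivAt.clm_apply (hasFDerivAt_const v w)
    have h2 : HasFDerivAt (fun w => E.conn w v) _ w :=
      (hE.clm_apply (differentiableAt_const v)).hasFDerivAt
    have h3 : fderiv ℝ (fun w => Ψ.conn w v) w = _ := (h2.add (hinv.hasFDerivAt.mul h1)).fderiv
    rw [h3]
    simp
    ring
  have hinv' : fderiv ℝ (fun w => (Ψ.toFun w)⁻¹) w
      = -((Ψ.toFun w) ^ 2)⁻¹ • fderiv ℝ Ψ.toFun w := by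
    have h : HasFDerivAt (fun x : ℂ => x⁻¹) _ (Ψ.toFun w) :=
      (hasDerivAt_inv (Ψ.ne_zero w)).hasFDerivAt.restrictScalars ℝ
    have h1 : fderiv ℝ (fun w => (Ψ.toFun w)⁻¹) w = _ := (h.comp w hu.hasFDerivAt).fderiv
    rw [h1]
    ext v
    simp [mul_comm]
  refine alternatingMap_ext fun u v => ?_
  have hΨ : DifferentiableAt ℝ Ψ.conn w := hE.add hB
  rw [curvature_apply hΨ, curvature_apply hE, happly, happly, hinv', hsymm u v]
  simp
  ring

end Curvature

/-! ### Explicit curvatures and metrics -/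

/-- The connection form on a fixed vector is real linear in the base point, so its derivative is
itself and the curvature is constant. -/
theorem curvature_isoCalP_conn (w u v : ℂ × ConjDual) :
    curvature (isoCalP δ τ).conn w ![u, v]
      = 2 * Real.pi * Complex.I * (u.2 v.1 + conj (u.2 v.1) - (v.2 u.1 + conj (v.2 u.1))) := by
  have hd : ∀ v u : ℂ × ConjDual, fderiv ℝ (fun w => (isoCalP δ τ).conn w v) w u
      = 2 * Real.pi * Complex.I * (u.2 v.1 + conj (u.2 v.1)) := by
    intro v u
    set T : ℂ × ConjDual →L[ℝ] ℂ := (2 * Real.pi * Complex.I : ℂ) •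
      (((evalAt v.1).restrictScalars ℝ).comp (ContinuousLinearMap.snd ℝ ℂ ConjDual)
      + (Complex.conjCLE : ℂ →L[ℝ] ℂ).comp
        (((evalAt v.1).restrictScalars ℝ).comp (ContinuousLinearMap.snd ℝ ℂ ConjDual))) with hT
    have h : (fun w => (isoCalP δ τ).conn w v) = T := by
      funext w
      rw [isoCalP_conn_apply]
      have := Complex.add_conj (w.2 v.1)
      simp [hT]
      push_cast at this
      linear_combination (-2 * Real.pi * Complex.I) * this
    rw [h, T.fderiv]
    simp [hT]
    ring
  rw [curvature_apply ((isoCalP δ τ).conn_smooth.differentiable (by simp) w), hd, hd]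
  ring

/-- Polarization: (z₂ + μ₂)² - z₂² - μ₂² = 2z₂μ₂. -/
theorem hJ_apply (w : ℂ × ℂ) :
    (hJ δ τ).toFun w = Real.exp (-(4 * Real.pi / τ.im) * w.1.im * w.2.im) := by
  change Real.exp _ / (Real.exp _ * Real.exp _) = _
  rw [← Real.exp_add, ← Real.exp_sub]
  congr 1
  ring

/-- Here log h = -(4π/τ₂)z₂μ₂, and ∂̄z₂ = (i/2)dz̄, ∂̄μ₂ = (i/2)dμ̄. -/
theorem part01_hJ (w : ℂ × ℂ) :
    part01 (fderiv ℝ (fun w' => ((Real.log ((hJ δ τ).toFun w') : ℝ) : ℂ)) w)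
      = (-(2 * Real.pi * Complex.I / τ.im) * w.1.im : ℂ) •
          (Complex.conjCLE : ℂ →L[ℝ] ℂ).comp (ContinuousLinearMap.snd ℝ ℂ ℂ)
        + (-(2 * Real.pi * Complex.I / τ.im) * w.2.im : ℂ) •
          (Complex.conjCLE : ℂ →L[ℝ] ℂ).comp (ContinuousLinearMap.fst ℝ ℂ ℂ) := by
  have hlog : (fun w' => ((Real.log ((hJ δ τ).toFun w') : ℝ) : ℂ))
      = fun w' : ℂ × ℂ => (-(4 * Real.pi / τ.im) : ℂ) * ((w'.1.im : ℂ) * (w'.2.im : ℂ)) := by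
    funext w'
    rw [hJ_apply, Real.log_exp]
    push_cast
    ring
  have him : ∀ T : ℂ × ℂ →L[ℝ] ℂ, HasFDerivAt (fun w' : ℂ × ℂ => ((T w').im : ℂ))
      (Complex.ofRealCLM.comp (Complex.imCLM.comp T)) w :=
    fun T => (Complex.ofRealCLM.comp (Complex.imCLM.comp T)).hasFDerivAt
  have h := ((him (ContinuousLinearMap.fst ℝ ℂ ℂ)).mul
    (him (ContinuousLinearMap.snd ℝ ℂ ℂ))).const_mul (-(4 * Real.pi / τ.im) : ℂ)
  have h' : fderiv ℝ (fun w' : ℂ × ℂ =>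
      (-(4 * Real.pi / τ.im) : ℂ) * ((w'.1.im : ℂ) * (w'.2.im : ℂ))) w = _ := h.fderiv
  rw [hlog, h']
  refine ContinuousLinearMap.ext fun v => ?_
  have hc : ∀ z : ℂ, conj z = z.re - z.im * Complex.I := fun z => by
    apply Complex.ext <;> simp
  rw [part01_apply]
  simp [hc]
  linear_combination (-2 * Real.pi / τ.im * (w.1.im * v.2.im + w.2.im * v.1.im) : ℂ) * Complex.I_sq

/-- The form ∂̄ log h has coefficients linear in z₂ and μ₂. After 2i dz₂ = dz - dz̄ and 2i dμ₂ = dμ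
- dμ̄, the terms dz̄ ∧ dμ̄ and dμ̄ ∧ dz̄ cancel. -/
theorem hJ_curvature_apply (w u v : ℂ × ℂ) :
    (hJ δ τ).curvature w ![u, v] = (Real.pi / τ.im : ℂ) *
      (wedge (fun x : ℂ × ℂ => x.1) (fun x : ℂ × ℂ => (starRingEnd ℂ) x.2) u v
        + wedge (fun x : ℂ × ℂ => x.2) (fun x : ℂ × ℂ => (starRingEnd ℂ) x.1) u v) := by
  have hA : (fun w => part01 (fderiv ℝ (fun w' => ((Real.log ((hJ δ τ).toFun w') : ℝ) : ℂ)) w))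
      = _ := funext part01_hJ
  change -(curvature _ w ![u, v]) = _
  rw [hA]
  have hd : ∀ v u : ℂ × ℂ, fderiv ℝ (fun w : ℂ × ℂ =>
      ((-(2 * Real.pi * Complex.I / τ.im) * w.1.im : ℂ) •
          (Complex.conjCLE : ℂ →L[ℝ] ℂ).comp (ContinuousLinearMap.snd ℝ ℂ ℂ)
        + (-(2 * Real.pi * Complex.I / τ.im) * w.2.im : ℂ) •
          (Complex.conjCLE : ℂ →L[ℝ] ℂ).comp (ContinuousLinearMap.fst ℝ ℂ ℂ)) v) w u
      = -(2 * Real.pi * Complex.I / τ.im) * (u.1.im * conj v.2 + u.2.im * conj v.1) := by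
    intro v u
    set T : ℂ × ℂ →L[ℝ] ℂ :=
      (-(2 * Real.pi * Complex.I / τ.im) * conj v.2 : ℂ) •
        Complex.ofRealCLM.comp (Complex.imCLM.comp (ContinuousLinearMap.fst ℝ ℂ ℂ))
      + (-(2 * Real.pi * Complex.I / τ.im) * conj v.1 : ℂ) •
        Complex.ofRealCLM.comp (Complex.imCLM.comp (ContinuousLinearMap.snd ℝ ℂ ℂ)) with hT
    have h : (fun w : ℂ × ℂ =>
      ((-(2 * Real.pi * Complex.I / τ.im) * w.1.im : ℂ) •
          (Complex.conjCLE : ℂ →L[ℝ] ℂ).comp (ContinuousLinearMap.snd ℝ ℂ ℂ)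
        + (-(2 * Real.pi * Complex.I / τ.im) * w.2.im : ℂ) •
          (Complex.conjCLE : ℂ →L[ℝ] ℂ).comp (ContinuousLinearMap.fst ℝ ℂ ℂ)) v) = T := by
      funext w
      simp [hT]
      ring
    rw [h, T.fderiv]
    simp [hT]
    ring
  have him : ∀ T : ℂ × ℂ →L[ℝ] ℂ, DifferentiableAt ℝ (fun w' : ℂ × ℂ => ((T w').im : ℂ)) w :=
    fun T => (Complex.ofRealCLM.comp (Complex.imCLM.comp T)).differentiableAt
  rw [curvature_apply, hd, hd]
  · have h : ∀ z : ℂ, 2 * Complex.I * z.im = z - conj z := fun z => by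
      rw [conj_eq_sub]; ring
    simp only [wedge]
    linear_combination (Real.pi / τ.im : ℂ) * (conj v.2 * h u.1 + conj v.1 * h u.2
      - conj u.2 * h v.1 - conj u.1 * h v.2)
  · exact (((him (ContinuousLinearMap.fst ℝ ℂ ℂ)).const_mul _).smul_const _).add
      (((him (ContinuousLinearMap.snd ℝ ℂ ℂ)).const_mul _).smul_const _)

theorem pullForm_apply (ρ : ℂ →L[ℂ] ConjDual)
    (Θ : ℂ × ConjDual → (ℂ × ConjDual) [⋀^Fin 2]→L[ℝ] ℂ) (w u v : ℂ × ℂ) :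
    pullForm ρ Θ w ![u, v] = Θ (idProd ρ w) ![idProd ρ u, idProd ρ v] := by
  change Θ (idProd ρ w) (fun i => idProd ρ (![u, v] i)) = _
  congr 1
  funext i
  fin_cases i <;> rfl

theorem pullForm_curvature {P : HolLineBundle (ℂ × ConjDual) (prodLattice δ τ)}
    (Ψ : HolIsoToConn P (isoCalP δ τ)) (w : ℂ × ℂ) :
    pullForm (phiLift τ) (curvature Ψ.conn) w = (hJ δ τ).curvature w := by
  refine alternatingMap_ext fun u v => ?_
  rw [pullForm_apply, Ψ.curvature_conn, curvature_isoCalP_conn, hJ_curvature_apply]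
  have h : ∀ u : ℂ × ℂ, idProd (phiLift τ) u = (u.1, phiLift τ u.2) := fun _ => rfl
  simp only [h, wedge]
  linear_combination two_pi_I_mul_phiLift (τ := τ) u.2 v.1
    + two_pi_I_mul_conj_phiLift (τ := τ) u.2 v.1 - two_pi_I_mul_phiLift (τ := τ) v.2 u.1
    - two_pi_I_mul_conj_phiLift (τ := τ) v.2 u.1

/-- The two exponents are -(π/τ₂)μz̄ and -(π/τ₂)μz; their real parts differ by -(2π/τ₂)z₂μ₂, and
squaring the norm doubles this to the exponent of h_J. -/
theorem normSq_poincareIsoConn (hρ : IsLift δ τ (phiMap δ τ) (phiLift τ)) (w : ℂ × ℂ) :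
    ‖(poincareIsoConn δ τ).toFun (idProd (phiLift τ) w)‖ ^ 2
      = (hJ δ τ).toFun w * ‖(poincareIsoJ hρ).toFun w‖ ^ 2 := by
  change ‖Complex.exp (-2 * Real.pi * Complex.I * phiLift τ w.2 w.1)‖ ^ 2
    = _ * ‖Complex.exp (-Real.pi / τ.im * (w.1 * w.2))‖ ^ 2
  have h : -2 * Real.pi * Complex.I * phiLift τ w.2 w.1
      = ((-(Real.pi / τ.im) : ℝ) : ℂ) * (w.2 * conj w.1) := by
    push_cast
    linear_combination -two_pi_I_mul_phiLift (τ := τ) w.2 w.1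
  have h' : (-Real.pi / τ.im * (w.1 * w.2) : ℂ)
      = ((-(Real.pi / τ.im) : ℝ) : ℂ) * (w.1 * w.2) := by
    push_cast; ring
  rw [normSq_exp, normSq_exp, hJ_apply, ← Real.exp_add, h, h', Complex.re_ofReal_mul,
    Complex.re_ofReal_mul]
  congr 1
  simp
  ring

end PoincareTorus

end

/-! ### The main theorem -/

open PoincareTorus in
theorem mainTheorem10 (δ : ℕ) (hδ : 0 < δ) (τ : UpperHalfPlane) :
    (∃! φ : ℂ ⧸ PoincareTorus.lattice δ τ →
        PoincareTorus.ConjDual ⧸ PoincareTorus.conjDualLattice δ τ,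
      PoincareTorus.IsPhi δ τ φ) ∧
    (∃ P : PoincareTorus.HolLineBundle (ℂ × PoincareTorus.ConjDual)
        (PoincareTorus.prodLattice δ τ),
      PoincareTorus.IsPoincare P) ∧
    ∀ φ : ℂ ⧸ PoincareTorus.lattice δ τ →
        PoincareTorus.ConjDual ⧸ PoincareTorus.conjDualLattice δ τ,
      PoincareTorus.IsPhi δ τ φ →
      (∃! ρ : ℂ →L[ℂ] PoincareTorus.ConjDual, PoincareTorus.IsLift δ τ φ ρ) ∧
      ∀ (ρ : ℂ →L[ℂ] PoincareTorus.ConjDual) (hρ : PoincareTorus.IsLift δ τ φ ρ)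
        (P : PoincareTorus.HolLineBundle (ℂ × PoincareTorus.ConjDual)
          (PoincareTorus.prodLattice δ τ)),
        PoincareTorus.IsPoincare P →
        -- a trivialization of the restriction of `P` to `{0} × M̂`
        ∀ t : PoincareTorus.HolIso (PoincareTorus.HolLineBundle.trivial PoincareTorus.ConjDual
            (PoincareTorus.conjDualLattice δ τ)) (PoincareTorus.restrictZero P),
          -- the identifications of the line bundles that respect this trivialization
          (∃! Ψ : PoincareTorus.HolIsoToConn P (PoincareTorus.isoCalP δ τ),
            ∀ α, Ψ.toFun (0, α) * t.toFun α = 1) ∧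
          (∃! Φ : PoincareTorus.HolIso (PoincareTorus.pullIdPhi hρ P) (PoincareTorus.J δ τ),
            ∀ μ, Φ.toFun (0, μ) * t.toFun (ρ μ) = 1) ∧
          ∀ Ψ : PoincareTorus.HolIsoToConn P (PoincareTorus.isoCalP δ τ),
            (∀ α, Ψ.toFun (0, α) * t.toFun α = 1) →
          ∀ Φ : PoincareTorus.HolIso (PoincareTorus.pullIdPhi hρ P) (PoincareTorus.J δ τ),
            (∀ μ, Φ.toFun (0, μ) * t.toFun (ρ μ) = 1) →
            -- the curvatures
            ((∀ w, PoincareTorus.pullForm ρ (PoincareTorus.curvature Ψ.conn) w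
                = (PoincareTorus.hJ δ τ).curvature w) ∧
              ∀ w u v : ℂ × ℂ, (PoincareTorus.hJ δ τ).curvature w ![u, v]
                = (Real.pi / τ.im : ℂ) *
                  (PoincareTorus.wedge (fun x : ℂ × ℂ => x.1)
                      (fun x : ℂ × ℂ => (starRingEnd ℂ) x.2) u v
                    + PoincareTorus.wedge (fun x : ℂ × ℂ => x.2)
                      (fun x : ℂ × ℂ => (starRingEnd ℂ) x.1) u v)) ∧
            -- the metrics
            ((∀ w, Ψ.metric.toFun (PoincareTorus.idProd ρ w)
                = (PoincareTorus.hJ δ τ).toFun w * ‖Φ.toFun w‖ ^ 2) ∧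
              ∀ w : ℂ × ℂ, (PoincareTorus.hJ δ τ).toFun w
                = Real.exp (-(4 * Real.pi / τ.im) * w.1.im * w.2.im)) := by
  have hΛ := isCobounded_lattice hδ τ
  refine ⟨⟨phiMap δ τ, isPhi_phiMap δ τ, fun φ hφ => hφ.eq_phiMap hδ⟩,
    ⟨poincareBundle δ τ, isPoincare_poincareBundle δ τ⟩, fun φ hφ => ?_⟩
  obtain rfl := hφ.eq_phiMap hδ
  refine ⟨⟨phiLift τ, isLift_phiLift δ τ, fun ρ hρ => hρ.eq_phiLift hδ⟩,
    fun ρ hρ P hP t => ?_⟩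
  obtain rfl := hρ.eq_phiLift hδ
  obtain ⟨f, hf⟩ := exists_holIso_poincareBundle hδ hP t
  have ht := t.ne_zero
  have hΨ₀ : ∀ α, (f.toConn (poincareIsoConn δ τ)).toFun (0, α) * t.toFun α = 1 := fun α => by
    rw [← hf α]
    simp [HolIso.toConn, poincareIsoConn]
  have hΨ : ∀ Ψ : HolIsoToConn P (isoCalP δ τ), (∀ α, Ψ.toFun (0, α) * t.toFun α = 1) →
      Ψ = f.toConn (poincareIsoConn δ τ) := fun Ψ h =>
    HolIsoToConn.eq_of_eq_on_zero hΛ fun α =>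
      mul_right_cancel₀ (ht α) ((h α).trans (hΨ₀ α).symm)
  have hΦ₀ : ∀ μ, ((f.pullIdPhi hρ).trans (poincareIsoJ hρ)).toFun (0, μ)
      * t.toFun (phiLift τ μ) = 1 := fun μ => by
    rw [← hf (phiLift τ μ)]
    simp [HolIso.trans, HolIso.pullIdPhi, poincareIsoJ, idProd]
  have hΦ : ∀ Φ : HolIso (pullIdPhi hρ P) (J δ τ),
      (∀ μ, Φ.toFun (0, μ) * t.toFun (phiLift τ μ) = 1) →
      Φ = (f.pullIdPhi hρ).trans (poincareIsoJ hρ) := fun Φ h =>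
    HolIso.eq_of_eq_on_zero hΛ fun μ =>
      mul_right_cancel₀ (ht (phiLift τ μ)) ((h μ).trans (hΦ₀ μ).symm)
  refine ⟨⟨_, hΨ₀, hΨ⟩, ⟨_, hΦ₀, hΦ⟩, fun Ψ h Φ h' => ?_⟩
  refine ⟨⟨pullForm_curvature Ψ, hJ_curvature_apply⟩, fun w => ?_, hJ_apply⟩
  -- By uniqueness Ψ and Φ are the explicit isomorphisms composed with the same f, so |f|² occurs on
  -- both sides and only the model case remains.
  rw [hΨ Ψ h, hΦ Φ h']
  change 1 * ‖(poincareIsoConn δ τ).toFun (idProd (phiLift τ) w)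
      * f.toFun (idProd (phiLift τ) w)‖ ^ 2 = (hJ δ τ).toFun w
    * ‖(poincareIsoJ hρ).toFun w * f.toFun (idProd (phiLift τ) w)‖ ^ 2
  rw [one_mul, norm_mul, norm_mul, mul_pow, mul_pow, normSq_poincareIsoConn hρ, mul_assoc]
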